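/- All Banach spaces are over the complex field $\mathbb{C}$, and $\mathcal{B}(X)$ denotes the algebra of bounded linear operators on a Banach space $X$. A Banach space $X$ has the SHAI property (Surjective Homomorphisms Are Injective) if for every non-zero Banach space $Y$, every surjective algebra homomorphism $\psi : \mathcal{B}(X) \to \mathcal{B}(Y)$ (a linear and multiplicative map, with no continuity assumed) is injective. Proposition. Suppose $X$ is one of the Banach spaces of complex sequences $c_0$ (null sequences with the supremum norm) or $\ell_p = \ell_p(\mathbb{N})$ for $1 \leq p \leq \infty$. Then $X$ has the SHAI property. -/

import Mathlib

open scoped ENNReal ZeroAtInfty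

universe u v

/-- A complex Banach space `X` has the SHAI property (Surjective Homomorphisms Are Injective) if
for every non-zero complex Banach space `Y`, every surjective algebra homomorphism from the algebra
of bounded linear operators on `X` onto that of `Y` is injective. An algebra homomorphism is a
linear multiplicative map; neither continuity nor preservation of the identity is assumed. -/
def HasSHAI (X : Type u) [NormedAddCommGroup X] [NormedSpace ℂ X] [CompleteSpace X] : Prop :=
  ∀ (Y : Type v) [NormedAddCommGroup Y] [NormedSpace ℂ Y] [CompleteSpace Y] [Nontrivial Y]
    (ψ : (X →L[ℂ] X) →ₙₐ[ℂ] (Y →L[ℂ] Y)), Function.Surjective ψ → Function.Injective ψ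

/-!
Let `ψ` be a surjective homomorphism from the operators on `X` onto those on `Y` which kills some
nonzero operator. Then it kills all finite-rank operators. Let `p` be an idempotent of rank one on
`Y`, and `T` an operator with `ψ T = p`. If `T` factors the identity of `X`, then the identity
of `Y` factors through `p`, so `Y` is one-dimensional; this is impossible because `X` contains
two mutually orthogonal complemented copies of itself. If `1 - T` has a left inverse modulo the
finite-rank operators, then `1 - p` has a left inverse, which is absurd. So it is enough that every operator `T` on `X` has one
of these two properties (`HasSHAI.of_dichotomy`). No continuity of `ψ` is involved.

For `c₀` and `ℓ_p` with `p < ∞`, both described by a `HomogeneousBasis`, let `Q n` be the projection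
onto the coordinates from `n` on. If `‖Q n * T‖ < 1` for some `n`, then `1 - Q n * T` is invertible and
differs from `1 - T` by a finite-rank operator. Otherwise a gliding hump produces disjointly
supported vectors and functionals on which the matrix of `T` is a small perturbation of the identity
(`HomogeneousBasis.exists_factorization`).

For `ℓ_∞`, the alternative is whether the norms of the restrictions of `T` to disjoint sets of
coordinates have to become small. If not, Rosenthal's lemma shows that `T` factors the
identity (`LInfty.exists_factorization`). If so, `T` is controlled by finitely many of its coordinate
functionals (`ExhaustiveFamily.exists_control`), that is, by a finitely additive measure. On a
subspace where `T` is close to the identity the sup norm is then dominated by the `L²` norm of that measure,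
which bounds the dimension (`card_mul_le_sum_of_evaluation_bound`). Hence `1 - T` is bounded below
on a closed subspace of finite codimension, and its inverse there extends to an operator on `ℓ_∞`
because `ℓ_∞` is injective (`LInfty.exists_leftInverse`).
-/

open Filter Topology

/-! ### The dichotomy criterion -/

section Criterion

variable {X : Type u} [NormedAddCommGroup X] [NormedSpace ℂ X]

/-- Every rank-one operator factors through any nonzero operator, so a multiplicative map that
kills a nonzero operator kills all rank-one operators. -/
theorem map_smulRight_eq_zero {B : Type*} [NonUnitalSemiring B] [Module ℂ B]
    (ψ : (X →L[ℂ] X) →ₙₐ[ℂ] B) {S : X →L[ℂ] X} (hS : S ≠ 0) (hψ : ψ S = 0)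
    (g : X →L[ℂ] ℂ) (w : X) : ψ (g.smulRight w) = 0 := by
  obtain ⟨x, hx⟩ : ∃ x, S x ≠ 0 := by
    by_contra! h
    exact hS (ContinuousLinearMap.ext h)
  obtain ⟨h, hh⟩ := SeparatingDual.exists_eq_one (R := ℂ) hx
  have : g.smulRight w = h.smulRight w * S * g.smulRight x := by
    ext y
    simp [hh]
  rw [this, map_mul, map_mul, hψ, mul_zero, zero_mul]

theorem map_eq_zero_of_finiteDimensional_range {B : Type*} [NonUnitalSemiring B] [Module ℂ B]
    (ψ : (X →L[ℂ] X) →ₙₐ[ℂ] B) {S : X →L[ℂ] X} (hS : S ≠ 0) (hψ : ψ S = 0)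
    (F : X →L[ℂ] X) [FiniteDimensional ℂ F.range] : ψ F = 0 := by
  let b := Module.finBasis ℂ F.range
  have hF : F = ∑ i, ((LinearMap.toContinuousLinearMap (b.coord i)).comp
      F.rangeRestrict).smulRight (b i : X) := by
    ext x
    have := congrArg Subtype.val (b.sum_repr (F.rangeRestrict x))
    rw [AddSubmonoidClass.coe_finsetSum] at this
    rw [sum_apply]
    exact this.symm
  rw [hF, map_sum]
  exact Finset.sum_eq_zero fun i _ => map_smulRight_eq_zero ψ hS hψ _ _

/-- If an operator `F` vanishes on a finite intersection of kernels of functionals, then it has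
finite rank. -/
theorem finiteDimensional_range_of_ker_le {ι : Type*} [Finite ι] (f : ι → X →L[ℂ] ℂ)
    (F : X →L[ℂ] X) (hF : ∀ x, (∀ i, f i x = 0) → F x = 0) : FiniteDimensional ℂ F.range := by
  let G : X →ₗ[ℂ] (ι → ℂ) := LinearMap.pi fun i => (f i : X →ₗ[ℂ] ℂ)
  have hle : LinearMap.ker G ≤ LinearMap.ker (F : X →ₗ[ℂ] X) := fun x hx =>
    hF x fun i => congrFun (show G x = 0 from hx) i
  have : FiniteDimensional ℂ (X ⧸ LinearMap.ker G) :=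
    Module.Finite.equiv G.quotKerEquivRange.symm
  have : FiniteDimensional ℂ (X ⧸ LinearMap.ker (F : X →ₗ[ℂ] X)) :=
    Module.Finite.of_surjective _ (Submodule.factor_surjective hle)
  exact Module.Finite.equiv (F : X →ₗ[ℂ] X).quotKerEquivRange

/-- The criterion through which all the spaces are handled: `X` has the SHAI property if it
contains two complementary-type copies of itself, and every operator `T` on it either factors
the identity, or `1 - T` is left invertible modulo the finite-rank operators. -/
theorem HasSHAI.of_dichotomy [CompleteSpace X]
    (A B : Fin 2 → X →L[ℂ] X) (hAB : ∀ i j, A i * B j = if i = j then 1 else 0)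
    (hT : ∀ T : X →L[ℂ] X, (∃ A B : X →L[ℂ] X, A * T * B = 1) ∨
      ∃ R : X →L[ℂ] X, FiniteDimensional ℂ (R * (1 - T) - 1).range) :
    HasSHAI.{u, v} X := by
  intro Y _ _ _ _ ψ hψ
  by_contra hinj
  obtain ⟨S, hS, hS0⟩ : ∃ S, ψ S = 0 ∧ S ≠ 0 := by
    by_contra! h
    exact hinj ((injective_iff_map_eq_zero ψ).2 h)
  have h1 : ψ 1 = 1 := by
    obtain ⟨E, hE⟩ := hψ 1
    calc ψ 1 = ψ 1 * ψ E := by rw [hE, mul_one]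
      _ = 1 := by rw [← map_mul, one_mul, hE]
  obtain ⟨y, hy⟩ := exists_ne (0 : Y)
  obtain ⟨f, hf⟩ := SeparatingDual.exists_eq_one (R := ℂ) hy
  obtain ⟨T, hTp⟩ := hψ (f.smulRight y)
  rcases hT T with ⟨C, D, h⟩ | ⟨R, hR⟩
  · -- the identity of `Y` has rank one, so all operators on `Y` are scalar and commute
    have hI : ∀ z : Y, z = f (ψ D z) • ψ C y := fun z => by
      have := congrArg (fun F => ψ F z) h
      simp only [map_mul, hTp, h1] at this
      simpa using this.symm
    have hscal : ∀ F G : Y →L[ℂ] Y, F * G = G * F := fun F G => by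
      have key : ∀ F : Y →L[ℂ] Y, ∃ c : ℂ, ∀ z, F z = c • z := fun F =>
        ⟨f (ψ D (F (ψ C y))), fun z => by
          conv_lhs => rw [hI z, map_smul, hI (F (ψ C y)), smul_comm, ← hI z]⟩
      obtain ⟨a, ha⟩ := key F
      obtain ⟨b, hb⟩ := key G
      ext z
      simp [ha, hb, smul_comm a b]
    have e : ∀ i j, ψ (A i) * ψ (B j) = if i = j then 1 else 0 := fun i j => by
      rw [← map_mul, hAB]; split_ifs <;> simp [h1]
    have : (1 : Y →L[ℂ] Y) = 0 := by
      calc (1 : Y →L[ℂ] Y) = (ψ (A 0) * ψ (B 0)) * (ψ (A 1) * ψ (B 1)) := by simp [e]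
        _ = (ψ (A 0) * ψ (B 1)) * (ψ (A 1) * ψ (B 0)) := by
          rw [hscal (ψ (A 1)), mul_assoc, ← mul_assoc (ψ (B 0)), hscal (ψ (B 0)), mul_assoc,
            mul_assoc, hscal (ψ (B 0))]
        _ = 0 := by simp [e]
    exact one_ne_zero this
  · have h0 := map_eq_zero_of_finiteDimensional_range ψ hS0 hS (R * (1 - T) - 1)
    rw [map_sub, map_mul, map_sub, hTp, h1, sub_eq_zero] at h0
    have := congrArg (fun F => F y) h0
    simp [hf] at this
    exact hy this.symm

end Criterion

/-! ### Homogeneous bases -/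

/-- A normalised Schauder basis `vec` of `X`, with coordinate functionals `coord`, in which the norm
of a sum of disjointly supported vectors is a monotone function of their norms alone. The unit
vector bases of `c₀` and of `ℓ_p`, `p < ∞`, are the examples. -/
structure HomogeneousBasis (X : Type u) [NormedAddCommGroup X] [NormedSpace ℂ X] where
  /-- the basis vectors -/
  vec : ℕ → X
  /-- the coordinate functionals -/
  coord : ℕ → X →L[ℂ] ℂ
  coord_vec : ∀ i j, coord i (vec j) = if i = j then 1 else 0
  norm_vec : ∀ i, ‖vec i‖ = 1
  tendsto_sum : ∀ x, Tendsto (fun n => ∑ i ∈ Finset.range n, coord i x • vec i) atTop (𝓝 x)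
  norm_sum_le : ∀ (s : Finset ℕ) (w z : ℕ → X),
    (∀ l m, l ≠ m → ∀ i, coord i (w l) = 0 ∨ coord i (w m) = 0) →
    (∀ l m, l ≠ m → ∀ i, coord i (z l) = 0 ∨ coord i (z m) = 0) →
    (∀ l ∈ s, ‖w l‖ ≤ ‖z l‖) → ‖∑ l ∈ s, w l‖ ≤ ‖∑ l ∈ s, z l‖

namespace HomogeneousBasis

variable {X : Type u} [NormedAddCommGroup X] [NormedSpace ℂ X] (B : HomogeneousBasis X)

/-- The coordinate projection onto the span of the basis vectors indexed by `S`. -/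
noncomputable def proj (S : Finset ℕ) : X →L[ℂ] X := ∑ i ∈ S, (B.coord i).smulRight (B.vec i)

theorem proj_apply (S : Finset ℕ) (x : X) : B.proj S x = ∑ i ∈ S, B.coord i x • B.vec i := by
  simp [proj]

theorem coord_proj (S : Finset ℕ) (i : ℕ) (x : X) :
    B.coord i (B.proj S x) = if i ∈ S then B.coord i x else 0 := by
  simp [proj_apply, B.coord_vec]

theorem proj_proj (S S' : Finset ℕ) (x : X) : B.proj S (B.proj S' x) = B.proj (S ∩ S') x := by
  rw [B.proj_apply S, B.proj_apply (S ∩ S'), ← Finset.filter_mem_eq_inter, Finset.sum_filter]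
  exact Finset.sum_congr rfl fun i _ => by rw [coord_proj]; split_ifs <;> simp

theorem coord_smul_vec_eq_zero_or {l m : ℕ} (hlm : l ≠ m) (a b : ℂ) (i : ℕ) :
    B.coord i (a • B.vec l) = 0 ∨ B.coord i (b • B.vec m) = 0 := by
  by_cases hi : i = l
  · right; simp [B.coord_vec, hi, hlm]
  · left; simp [B.coord_vec, hi]

theorem coord_vec_eq_zero_or {l m : ℕ} (hlm : l ≠ m) (i : ℕ) :
    B.coord i (B.vec l) = 0 ∨ B.coord i (B.vec m) = 0 := by
  simpa using B.coord_smul_vec_eq_zero_or hlm 1 1 i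

theorem norm_proj_le_of_subset {S S' : Finset ℕ} (h : S ⊆ S') (x : X) :
    ‖B.proj S x‖ ≤ ‖B.proj S' x‖ := by
  have h1 : B.proj S x = ∑ i ∈ S', (if i ∈ S then B.coord i x else 0) • B.vec i := by
    rw [proj_apply, ← Finset.inter_eq_right.2 h, ← Finset.filter_mem_eq_inter, Finset.sum_filter]
    exact Finset.sum_congr rfl fun i hi => by simp [hi]
  rw [h1, proj_apply]
  refine B.norm_sum_le S' _ _ (fun l m h => B.coord_smul_vec_eq_zero_or h _ _)
    (fun l m h => B.coord_smul_vec_eq_zero_or h _ _) fun l _ => ?_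
  by_cases hl : l ∈ S <;> simp [hl]

theorem tendsto_proj (x : X) :
    Tendsto (fun n => B.proj (Finset.range n) x) atTop (𝓝 x) := by
  simpa only [proj_apply] using B.tendsto_sum x

theorem norm_proj_le (S : Finset ℕ) (x : X) : ‖B.proj S x‖ ≤ ‖x‖ := by
  refine ge_of_tendsto (B.tendsto_proj x).norm ?_
  filter_upwards [eventually_ge_atTop (S.sup id + 1)] with n hn
  refine B.norm_proj_le_of_subset (fun i hi => Finset.mem_range.2 ?_) x
  have : i ≤ S.sup id := Finset.le_sup (f := id) hi
  omega

theorem norm_coord_le (i : ℕ) (x : X) : ‖B.coord i x‖ ≤ ‖x‖ := by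
  simpa [proj_apply, norm_smul, B.norm_vec] using B.norm_proj_le {i} x

/-- The projection onto the coordinates from `n` on. -/
noncomputable def tail (n : ℕ) : X →L[ℂ] X := 1 - B.proj (Finset.range n)

theorem tail_apply (n : ℕ) (x : X) : B.tail n x = x - B.proj (Finset.range n) x := rfl

theorem proj_Ico_eq {a b : ℕ} (h : a ≤ b) (x : X) :
    B.proj (Finset.Ico a b) x = B.proj (Finset.range b) x - B.proj (Finset.range a) x := by
  simp only [proj_apply, Finset.sum_Ico_eq_sub _ h]

theorem tendsto_proj_Ico (a : ℕ) (x : X) :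
    Tendsto (fun b => B.proj (Finset.Ico a b) x) atTop (𝓝 (B.tail a x)) := by
  refine ((B.tendsto_proj x).sub_const (B.proj (Finset.range a) x)).congr' ?_
  filter_upwards [eventually_ge_atTop a] with b hb
  rw [B.proj_Ico_eq hb]

theorem norm_tail_le (n : ℕ) (x : X) : ‖B.tail n x‖ ≤ ‖x‖ :=
  le_of_tendsto (B.tendsto_proj_Ico n x).norm (Eventually.of_forall fun _ => B.norm_proj_le _ x)

theorem tendsto_tail (x : X) : Tendsto (fun n => B.tail n x) atTop (𝓝 0) := by
  simpa [tail_apply] using (B.tendsto_proj x).const_sub x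

theorem proj_tail {S : Finset ℕ} {n : ℕ} (h : ∀ i ∈ S, n ≤ i) (x : X) :
    B.proj S (B.tail n x) = B.proj S x := by
  have : S ∩ Finset.range n = ∅ := by
    ext i
    simpa using h i
  rw [tail_apply, map_sub, proj_proj, this]
  simp [proj_apply]

theorem norm_tail_le_of_le {m n : ℕ} (h : m ≤ n) (x : X) : ‖B.tail n x‖ ≤ ‖B.tail m x‖ := by
  have : B.tail n x = B.tail n (B.tail m x) := by
    rw [tail_apply, tail_apply, B.tail_apply m, map_sub, proj_proj,
      Finset.inter_eq_right.2 (Finset.range_mono h)]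
    abel
  rw [this]
  exact B.norm_tail_le _ _

/-- Functionals `g k` that are dominated by pairwise disjoint blocks `S k` of coordinates, and
disjointly supported vectors `w k`, define an operator `x ↦ ∑ g k x • w k`. -/
theorem exists_operator [CompleteSpace X] (g : ℕ → X →L[ℂ] ℂ) (w : ℕ → X) (S : ℕ → Finset ℕ) (C : ℝ)
    (hS : ∀ l m, l ≠ m → Disjoint (S l) (S m)) (hS' : ∀ k, ∀ i ∈ S k, k ≤ i)
    (hw : ∀ l m, l ≠ m → ∀ i, B.coord i (w l) = 0 ∨ B.coord i (w m) = 0)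
    (hg : ∀ k x, ‖g k x • w k‖ ≤ C * ‖B.proj (S k) x‖) :
    ∃ R : X →L[ℂ] X, ∀ x, Tendsto (fun n => ∑ k ∈ Finset.range n, g k x • w k) atTop (𝓝 (R x)) := by
  have bound : ∀ m n, m ≤ n → ∀ x,
      ‖∑ k ∈ Finset.Ico m n, g k x • w k‖ ≤ |C| * ‖B.tail m x‖ := by
    intro m n _ x
    have hU : B.proj ((Finset.Ico m n).biUnion S) x = ∑ k ∈ Finset.Ico m n, B.proj (S k) x := by
      simp only [proj_apply]
      exact Finset.sum_biUnion fun l _ m _ h => hS l m h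
    have hle := B.norm_sum_le (Finset.Ico m n) (fun k => g k x • w k)
      (fun k => ((|C| : ℝ) : ℂ) • B.proj (S k) x)
      (fun l m h i => by rcases hw l m h i with h | h <;> simp [h])
      (fun l m h i => by
        by_cases hi : i ∈ S l
        · have : i ∉ S m := fun h' => Finset.disjoint_left.1 (hS l m h) hi h'
          simp [coord_proj, this]
        · simp [coord_proj, hi])
      (fun k _ => (hg k x).trans (by
        rw [norm_smul, Complex.norm_real, Real.norm_eq_abs, abs_abs]
        exact mul_le_mul_of_nonneg_right (le_abs_self C) (norm_nonneg _)))
    rw [← Finset.smul_sum, ← hU, norm_smul, Complex.norm_real, Real.norm_eq_abs, abs_abs] at hle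
    refine hle.trans (mul_le_mul_of_nonneg_left ?_ (abs_nonneg C))
    rw [← B.proj_tail (n := m)]
    · exact B.norm_proj_le _ _
    · intro i hi
      obtain ⟨k, hk, hik⟩ := Finset.mem_biUnion.1 hi
      exact (Finset.mem_Ico.1 hk).1.trans (hS' k i hik)
  have hc : ∀ x, ∃ y, Tendsto (fun n => ∑ k ∈ Finset.range n, g k x • w k) atTop (𝓝 y) := by
    intro x
    refine cauchySeq_tendsto_of_complete (cauchySeq_of_le_tendsto_0'
      (fun m => |C| * ‖B.tail m x‖) (fun m n h => ?_) ?_)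
    · rw [dist_comm, dist_eq_norm, ← Finset.sum_Ico_eq_sub _ h]
      exact bound m n h x
    · simpa using (B.tendsto_tail x).norm.const_mul |C|
  choose R hR using hc
  let G : ℕ → X →L[ℂ] X := fun n => ∑ k ∈ Finset.range n, (g k).smulRight (w k)
  have hG : Tendsto (fun n x => G n x) atTop (𝓝 R) :=
    tendsto_pi_nhds.2 fun x => by simpa [G] using hR x
  exact ⟨continuousLinearMapOfTendsto G hG, hR⟩

/-- If `T` stays away from the finite-rank operators, then unit vectors which `T` does not push
into the first `n` coordinates can be found inside any finite-codimensional subspace, up to `ε`: take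
the difference of two of them on which the given functionals nearly agree. -/
theorem exists_norm_tail_gt (T : X →L[ℂ] X) (hT : ∀ n, 1 ≤ ‖B.tail n * T‖)
    (G : Finset (X →L[ℂ] ℂ)) {ε : ℝ} (hε : 0 < ε) (n : ℕ) :
    ∃ z, ‖z‖ ≤ 1 ∧ (∀ g ∈ G, ‖g z‖ < ε) ∧ 1 / 8 < ‖B.tail n (T z)‖ := by
  have hx : ∀ n, ∃ x, ‖x‖ < 1 ∧ 1 / 2 < ‖B.tail n (T x)‖ := fun n =>
    (B.tail n * T).exists_lt_apply_of_lt_opNorm (by linarith [hT n])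
  choose x hx1 hx2 using hx
  obtain ⟨y, -, φ, hφ, hy⟩ := tendsto_subseq_of_bounded
    (x := fun n (g : G) => (g : X →L[ℂ] ℂ) (x n))
    (Metric.isBounded_closedBall (x := (0 : G → ℂ)) (r := ∑ g : G, ‖(g : X →L[ℂ] ℂ)‖))
    (fun n => by
      rw [mem_closedBall_zero_iff, pi_norm_le_iff_of_nonneg (by positivity)]
      intro g
      calc _ ≤ ‖(g : X →L[ℂ] ℂ)‖ * ‖x n‖ := ContinuousLinearMap.le_opNorm _ _
        _ ≤ ‖(g : X →L[ℂ] ℂ)‖ * 1 := by gcongr; exact (hx1 n).le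
        _ ≤ _ := by
          rw [mul_one]
          exact Finset.single_le_sum (f := fun g : G => ‖(g : X →L[ℂ] ℂ)‖)
            (fun _ _ => norm_nonneg _) (Finset.mem_univ g))
  obtain ⟨N, hN⟩ := Metric.cauchySeq_iff.1 hy.cauchySeq ε hε
  set i := max N n with hi
  have ev : ∀ᶠ m in atTop, ‖B.tail m (T (x (φ i)))‖ < 1 / 4 := by
    have := (B.tendsto_tail (T (x (φ i)))).norm
    rw [norm_zero] at this
    exact this.eventually_lt_const (by norm_num)
  obtain ⟨j, hj1, hj2⟩ := ((hφ.tendsto_atTop.eventually ev).and (eventually_ge_atTop (max N n))).exists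
  have hnj : n ≤ φ j := ((le_max_right N n).trans hj2).trans (hφ.id_le j)
  refine ⟨(1 / 2 : ℂ) • (x (φ j) - x (φ i)), ?_, fun g hg => ?_, ?_⟩
  · rw [norm_smul]
    have := norm_sub_le (x (φ j)) (x (φ i))
    have h1 := hx1 (φ j)
    have h2 := hx1 (φ i)
    norm_num
    linarith
  · have h1 := hN j ((le_max_left _ _).trans hj2) i (le_max_left _ _)
    have h2 := (dist_le_pi_dist _ _ (⟨g, hg⟩ : G)).trans_lt h1
    rw [dist_eq_norm] at h2
    simp only [Function.comp] at h2
    rw [map_smul, norm_smul, map_sub]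
    norm_num
    linarith [norm_nonneg (g (x (φ j)) - g (x (φ i)))]
  · refine lt_of_lt_of_le ?_ (B.norm_tail_le_of_le hnj _)
    rw [map_smul, map_smul, norm_smul, map_sub, map_sub]
    have := norm_sub_norm_le (B.tail (φ j) (T (x (φ j)))) (B.tail (φ j) (T (x (φ i))))
    have h2 := hx2 (φ j)
    norm_num
    linarith

end HomogeneousBasis

/-! ### The gliding hump -/

namespace HomogeneousBasis

variable {X : Type u} [NormedAddCommGroup X] [NormedSpace ℂ X] (B : HomogeneousBasis X)

/-- A hump of the operator `T`: a vector in the unit ball supported on an interval, which `T` maps to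
a vector whose restriction to that interval is bounded below, as witnessed by a functional that lives
on the interval. -/
structure Hump (T : X →L[ℂ] X) where
  /-- the generation of the hump, which controls its interaction with earlier humps -/
  gen : ℕ
  /-- the left end of the interval -/
  left : ℕ
  /-- the right end of the interval -/
  right : ℕ
  /-- the vector -/
  vec : X
  /-- the functional -/
  func : X →L[ℂ] ℂ
  gen_le : gen ≤ left
  norm_vec_le : ‖vec‖ ≤ 1
  proj_vec : B.proj (Finset.Ico left right) vec = vec
  norm_func_le : ∀ x, ‖func x‖ ≤ 16 * ‖B.proj (Finset.Ico left right) x‖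
  func_apply : func (T vec) = 1

theorem exists_hump (T : X →L[ℂ] X) (hT : ∀ n, 1 ≤ ‖B.tail n * T‖) {ε : ℝ} (hε : 0 < ε)
    (s : Finset (B.Hump T)) :
    ∃ h : B.Hump T, ∀ k ∈ s, k.gen < h.gen ∧ k.right ≤ h.left ∧
      ‖k.func (T h.vec)‖ ≤ ε * (1 / 4) ^ h.gen ∧ ‖h.func (T k.vec)‖ ≤ ε * (1 / 4) ^ h.gen := by
  classical
  set j := s.sup Hump.gen + 1 with hj
  have hδ : 0 < ε * (1 / 4 : ℝ) ^ j := by positivity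
  set δ := ε * (1 / 4 : ℝ) ^ j
  obtain ⟨a, ha1, ha2⟩ : ∃ a, (max j (s.sup Hump.right) ≤ a) ∧
      ∀ k ∈ s, ‖B.tail a (T k.vec)‖ < δ / 16 := by
    refine ((eventually_ge_atTop _).and ((Finset.eventually_all s).2 fun k _ => ?_)).exists
    have := (B.tendsto_tail (T k.vec)).norm
    rw [norm_zero] at this
    exact this.eventually_lt_const (by positivity)
  -- this small quantity makes the coordinates below `a` negligible after applying `T`
  set η : ℝ := 1 / (16 * (‖T‖ + 1) * (a + 1)) with hη
  have hη0 : 0 < η := by positivity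
  obtain ⟨z, hz1, hz2, hz3⟩ := B.exists_norm_tail_gt T hT
    (s.image (fun k => k.func.comp (T.comp (B.tail a))) ∪ (Finset.range a).image B.coord)
    (lt_min hδ hη0) a
  have hz4 : ‖T (B.proj (Finset.range a) z)‖ ≤ 1 / 16 := by
    have : ‖B.proj (Finset.range a) z‖ ≤ a * η := by
      rw [proj_apply]
      refine (norm_sum_le_of_le _ (f := fun i => B.coord i z • B.vec i) (n := fun _ => η)
        fun i hi => ?_).trans (by simp)
      rw [norm_smul, B.norm_vec, mul_one]
      exact ((hz2 _ (Finset.mem_union_right _ (Finset.mem_image_of_mem _ hi))).trans_le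
        (min_le_right _ _)).le
    calc _ ≤ ‖T‖ * (a * η) := T.le_opNorm_of_le this
      _ ≤ (‖T‖ + 1) * ((a + 1) * η) := by gcongr <;> linarith
      _ = 1 / 16 := by rw [hη]; field_simp
  have hz5 : 1 / 16 < ‖B.tail a (T (B.tail a z))‖ := by
    have : B.tail a (T (B.tail a z)) =
        B.tail a (T z) - B.tail a (T (B.proj (Finset.range a) z)) := by
      rw [B.tail_apply a z, map_sub, map_sub]
    rw [this]
    have h1 := norm_sub_norm_le (B.tail a (T z)) (B.tail a (T (B.proj (Finset.range a) z)))
    have h2 := B.norm_tail_le a (T (B.proj (Finset.range a) z))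
    linarith
  -- truncating at a large `m` changes none of these strict inequalities
  have hlim := B.tendsto_proj_Ico a z
  obtain ⟨m, hm1, hm2⟩ : ∃ m, (∀ k ∈ s, ‖k.func (T (B.proj (Finset.Ico a m) z))‖ < δ) ∧
      1 / 16 < ‖B.tail a (T (B.proj (Finset.Ico a m) z))‖ := by
    refine Eventually.exists (f := atTop) (((Finset.eventually_all s).2 fun k hk => ?_).and ?_)
    · refine (((k.func.comp T).continuous.tendsto _).comp hlim).norm.eventually_lt_const ?_
      exact (hz2 _ (Finset.mem_union_left _ (Finset.mem_image_of_mem _ hk))).trans_le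
        (min_le_left _ _)
    · exact ((((B.tail a).comp T).continuous.tendsto _).comp hlim).norm.eventually_const_lt hz5
  set w := B.proj (Finset.Ico a m) z
  obtain ⟨b, hb1, hb2⟩ := ((eventually_ge_atTop m).and
    ((B.tendsto_proj_Ico a (T w)).norm.eventually_const_lt hm2)).exists
  have hy0 : B.proj (Finset.Ico a b) (T w) ≠ 0 := fun h => by
    rw [h, norm_zero] at hb2
    norm_num at hb2
  obtain ⟨g, hg1, hg2⟩ := exists_dual_vector ℂ _ (norm_ne_zero_iff.2 hy0)
  set y := B.proj (Finset.Ico a b) (T w)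
  let f : X →L[ℂ] ℂ := ((‖y‖ : ℂ)⁻¹) • g.comp (B.proj (Finset.Ico a b))
  have hf : ∀ x, ‖f x‖ ≤ 16 * ‖B.proj (Finset.Ico a b) x‖ := fun x => by
    have h1 : ‖g (B.proj (Finset.Ico a b) x)‖ ≤ ‖B.proj (Finset.Ico a b) x‖ := by
      simpa [hg1] using g.le_opNorm (B.proj (Finset.Ico a b) x)
    have h2 : ‖y‖⁻¹ ≤ 16 := by
      rw [inv_le_comm₀ (by linarith) (by norm_num)]
      norm_num at hb2 ⊢
      exact hb2.le
    simp only [f, smul_apply, ContinuousLinearMap.comp_apply, norm_smul,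
      norm_inv, Complex.norm_real, norm_norm]
    gcongr
  refine ⟨⟨j, a, b, w, f, (le_max_left _ _).trans ha1, (B.norm_proj_le _ _).trans hz1, ?_, hf, ?_⟩,
    fun k hk => ⟨?_, ?_, (hm1 k hk).le, ?_⟩⟩
  · simp only [w]
    rw [proj_proj, Finset.inter_eq_right.2 (Finset.Ico_subset_Ico_right hb1)]
  · simp only [f, smul_apply, ContinuousLinearMap.comp_apply]
    rw [show g (B.proj (Finset.Ico a b) (T w)) = _ from hg2, smul_eq_mul]
    exact inv_mul_cancel₀ (by simpa using hy0)
  · exact Nat.lt_succ_of_le (Finset.le_sup (f := Hump.gen) hk)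
  · exact (Finset.le_sup (f := Hump.right) hk).trans ((le_max_right _ _).trans ha1)
  · refine (hf _).trans ?_
    rw [← B.proj_tail (n := a) (fun i hi => (Finset.mem_Ico.1 hi).1)]
    have h1 := B.norm_proj_le (Finset.Ico a b) (B.tail a (T k.vec))
    have h2 := ha2 k hk
    change _ ≤ δ
    linarith

/-- The gliding hump: an operator that is not within distance `1` of the operators
`B.proj (Finset.range n) * T` factors the identity. -/
theorem exists_factorization [CompleteSpace X] (T : X →L[ℂ] X) (hT : ∀ n, 1 ≤ ‖B.tail n * T‖) :
    ∃ A C : X →L[ℂ] X, A * T * C = 1 := by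
  classical
  have h16 : (0 : ℝ) < 1 / 8 := by norm_num
  obtain ⟨h, -, hh⟩ := exists_seq_of_forall_finset_exists (fun _ : B.Hump T => True) _
    (fun s _ => by
      obtain ⟨y, hy⟩ := B.exists_hump T hT h16 s
      exact ⟨y, trivial, hy⟩)
  have hgen : StrictMono fun n => (h n).gen := strictMono_nat_of_lt_succ fun n =>
    (hh n (n + 1) n.lt_succ_self).1
  have hgen' : ∀ n, n ≤ (h n).gen := hgen.id_le
  have hleft : ∀ n, n ≤ (h n).left := fun n => (hgen' n).trans (h n).gen_le
  have hdisj : ∀ l m, l ≠ m → Disjoint (Finset.Ico (h l).left (h l).right)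
      (Finset.Ico (h m).left (h m).right) := by
    have : ∀ l m, l < m → Disjoint (Finset.Ico (h l).left (h l).right)
        (Finset.Ico (h m).left (h m).right) := fun l m hlm => by
      refine Finset.disjoint_left.2 fun i hi hi' => ?_
      have := (hh l m hlm).2.1
      simp only [Finset.mem_Ico] at hi hi'
      omega
    intro l m hlm
    rcases hlm.lt_or_gt with hlm | hlm
    · exact this l m hlm
    · exact (this m l hlm).symm
  obtain ⟨C, hC⟩ := B.exists_operator B.coord (fun k => (h k).vec) (fun k => {k}) 1
    (fun l m hlm => by simpa using hlm) (fun k i hi => by simp_all)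
    (fun l m hlm i => by
      by_cases hi : i ∈ Finset.Ico (h l).left (h l).right
      · right
        rw [← (h m).proj_vec, coord_proj, if_neg (Finset.disjoint_left.1 (hdisj l m hlm) hi)]
      · left
        rw [← (h l).proj_vec, coord_proj, if_neg hi])
    (fun k x => by
      rw [norm_smul, one_mul]
      simp only [proj_apply, Finset.sum_singleton, norm_smul, B.norm_vec]
      gcongr
      exact (h k).norm_vec_le)
  obtain ⟨A, hA⟩ := B.exists_operator (fun k => (h k).func) B.vec
    (fun k => Finset.Ico (h k).left (h k).right) 16 hdisj
    (fun k i hi => (hleft k).trans (Finset.mem_Ico.1 hi).1) (fun l m => B.coord_vec_eq_zero_or)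
    (fun k x => by rw [norm_smul, B.norm_vec, mul_one]; exact (h k).norm_func_le x)
  -- the off-diagonal entries of the matrix of `A * T * C`
  have hoff : ∀ k l, k ≠ l → ‖(h k).func (T (h l).vec)‖ ≤ 1 / 8 * (1 / 2) ^ k * (1 / 2) ^ l := by
    have key : ∀ k l, k < l → 1 / 8 * (1 / 4 : ℝ) ^ (h l).gen ≤ 1 / 8 * (1 / 2) ^ k * (1 / 2) ^ l := by
      intro k l hkl
      rw [mul_assoc, ← pow_add, show (1 / 4 : ℝ) = (1 / 2) ^ 2 by norm_num, ← pow_mul]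
      refine mul_le_mul_of_nonneg_left ?_ (by norm_num)
      refine pow_le_pow_of_le_one (by norm_num) (by norm_num) ?_
      have := hgen' l
      omega
    intro k l hkl
    rcases hkl.lt_or_gt with hkl | hkl
    · exact (hh k l hkl).2.2.1.trans (key k l hkl)
    · refine (hh l k hkl).2.2.2.trans ((key l k hkl).trans_eq (by ring))
  have geom : ∀ n, ∑ k ∈ Finset.range n, (1 / 2 : ℝ) ^ k ≤ 2 := fun n =>
    sum_geometric_two_le n
  have hrow : ∀ k x, ‖(h k).func (T (C x)) - B.coord k x‖ ≤ 1 / 4 * (1 / 2) ^ k * ‖x‖ := by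
    intro k x
    have hlim : Tendsto (fun n => (∑ l ∈ Finset.range n,
        B.coord l x * (h k).func (T (h l).vec)) - B.coord k x) atTop
        (𝓝 ((h k).func (T (C x)) - B.coord k x)) := by
      have := (((h k).func.comp T).continuous.tendsto _).comp (hC x)
      refine (this.congr fun n => ?_).sub_const _
      simp
    refine le_of_tendsto hlim.norm ?_
    filter_upwards [eventually_gt_atTop k] with n hn
    rw [← Finset.add_sum_erase _ _ (Finset.mem_range.2 hn), (h k).func_apply, mul_one,
      add_sub_cancel_left]
    calc _ ≤ ∑ l ∈ (Finset.range n).erase k, ‖x‖ * (1 / 8 * (1 / 2) ^ k * (1 / 2) ^ l) := by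
          refine norm_sum_le_of_le _ fun l hl => ?_
          rw [norm_mul]
          gcongr
          · exact B.norm_coord_le l x
          · exact hoff k l (Finset.ne_of_mem_erase hl).symm
      _ ≤ ∑ l ∈ Finset.range n, ‖x‖ * (1 / 8 * (1 / 2) ^ k * (1 / 2) ^ l) :=
          Finset.sum_le_sum_of_subset_of_nonneg (Finset.erase_subset _ _) fun _ _ _ => by positivity
      _ = ‖x‖ * (1 / 8 * (1 / 2) ^ k) * ∑ l ∈ Finset.range n, (1 / 2 : ℝ) ^ l := by
          rw [Finset.mul_sum]
          exact Finset.sum_congr rfl fun _ _ => by ring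
      _ ≤ ‖x‖ * (1 / 8 * (1 / 2) ^ k) * 2 := by gcongr; exact geom n
      _ = _ := by ring
  have hnorm : ‖1 - A * T * C‖ < 1 := by
    refine (ContinuousLinearMap.opNorm_le_bound _ (by norm_num : (0 : ℝ) ≤ 1 / 2)
      fun x => ?_).trans_lt (by norm_num)
    have hlim := (hA (T (C x))).sub (B.tendsto_sum x)
    rw [← norm_neg, show -((1 - A * T * C) x) = A (T (C x)) - x by simp]
    refine le_of_tendsto hlim.norm (Eventually.of_forall fun n => ?_)
    rw [← Finset.sum_sub_distrib]
    calc _ ≤ ∑ k ∈ Finset.range n, 1 / 4 * (1 / 2) ^ k * ‖x‖ := by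
          refine norm_sum_le_of_le _ fun k _ => ?_
          rw [← sub_smul, norm_smul, B.norm_vec, mul_one]
          exact hrow k x
      _ = 1 / 4 * ‖x‖ * ∑ k ∈ Finset.range n, (1 / 2 : ℝ) ^ k := by
          rw [Finset.mul_sum]
          exact Finset.sum_congr rfl fun _ _ => by ring
      _ ≤ 1 / 4 * ‖x‖ * 2 := by gcongr; exact geom n
      _ = _ := by ring
  obtain ⟨U, hU⟩ := isUnit_one_sub_of_norm_lt_one hnorm
  rw [sub_sub_cancel] at hU
  exact ⟨↑U⁻¹ * A, C, by rw [mul_assoc, mul_assoc, ← mul_assoc A, ← hU, Units.inv_mul]⟩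

/-- The copies of the space spanned by the even and by the odd basis vectors. -/
theorem exists_two_copies (B : HomogeneousBasis X) [CompleteSpace X] :
    ∃ A C : Fin 2 → X →L[ℂ] X, ∀ i j, A i * C j = if i = j then 1 else 0 := by
  have hA : ∀ i : Fin 2, ∃ R : X →L[ℂ] X, ∀ x, Tendsto (fun n =>
      ∑ k ∈ Finset.range n, B.coord (2 * k + i) x • B.vec k) atTop (𝓝 (R x)) := fun i =>
    B.exists_operator (fun k => B.coord (2 * k + i)) B.vec (fun k => {2 * k + (i : ℕ)}) 1
      (fun l m hlm => by simp; omega) (fun k i hi => by simp at hi; omega) (fun l m => B.coord_vec_eq_zero_or)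
      (fun k x => by simp [norm_smul, proj_apply, B.norm_vec])
  have hC : ∀ i : Fin 2, ∃ R : X →L[ℂ] X, ∀ x, Tendsto (fun n =>
      ∑ k ∈ Finset.range n, B.coord k x • B.vec (2 * k + i)) atTop (𝓝 (R x)) := fun i =>
    B.exists_operator B.coord (fun k => B.vec (2 * k + i)) (fun k => {k}) 1
      (fun l m hlm => by simpa using hlm) (fun k i hi => by simp_all)
      (fun l m hlm => B.coord_vec_eq_zero_or (by omega))
      (fun k x => by simp [norm_smul, proj_apply, B.norm_vec])
  choose A hA using hA
  choose C hC using hC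
  have hAvec : ∀ i j : Fin 2, ∀ m, A i (B.vec (2 * m + j)) = if i = j then B.vec m else 0 := by
    intro i j m
    refine tendsto_nhds_unique (hA i _) (tendsto_const_nhds.congr' ?_)
    filter_upwards [eventually_gt_atTop m] with n hn
    rw [Finset.sum_eq_single_of_mem m (Finset.mem_range.2 hn)]
    · rw [B.coord_vec]
      by_cases hij : i = j
      · simp [hij]
      · have : ¬ 2 * m + (i : ℕ) = 2 * m + j := fun h => hij (Fin.ext (by omega))
        rw [if_neg this, if_neg hij, zero_smul]
    · intro k _ hk
      rw [B.coord_vec, if_neg (by omega), zero_smul]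
  refine ⟨A, C, fun i j => ContinuousLinearMap.ext fun x => ?_⟩
  refine tendsto_nhds_unique (((A i).continuous.tendsto _).comp (hC j x)) ?_
  simp only [Function.comp_def, map_sum, map_smul, hAvec]
  by_cases hij : i = j
  · simpa [hij] using B.tendsto_sum x
  · simp [hij]

theorem hasSHAI (B : HomogeneousBasis X) [CompleteSpace X] : HasSHAI.{u, v} X := by
  obtain ⟨A, C, hAC⟩ := B.exists_two_copies
  refine HasSHAI.of_dichotomy A C hAC fun T => ?_
  by_cases hT : ∀ n, 1 ≤ ‖B.tail n * T‖
  · exact Or.inl (B.exists_factorization T hT)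
  · right
    push Not at hT
    obtain ⟨n, hn⟩ := hT
    obtain ⟨U, hU⟩ := isUnit_one_sub_of_norm_lt_one hn
    refine ⟨↑U⁻¹, ?_⟩
    have h1 : (↑U⁻¹ : X →L[ℂ] X) * (1 - T) - 1 = -(↑U⁻¹ * (B.proj (Finset.range n) * T)) := by
      have : (1 - T : X →L[ℂ] X) = U - B.proj (Finset.range n) * T := by
        rw [hU, tail, sub_mul, one_mul]
        abel
      rw [this, mul_sub, Units.inv_mul]
      abel
    rw [h1]
    refine finiteDimensional_range_of_ker_le
      (fun i : Finset.range n => (B.coord i).comp T) _ fun x hx => ?_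
    have : B.proj (Finset.range n) (T x) = 0 := by
      rw [proj_apply]
      exact Finset.sum_eq_zero fun i hi => by
        rw [show B.coord i (T x) = 0 from hx ⟨i, hi⟩, zero_smul]
    simp [this]

end HomogeneousBasis

/-! ### The unit vector bases of `ℓ_p` and `c₀` -/

section SequenceSpaces

theorem lp.norm_rpow_add_of_disjoint {p : ℝ≥0∞} (hp : 0 < p.toReal) (f g : lp (fun _ : ℕ => ℂ) p)
    (h : ∀ i, f i = 0 ∨ g i = 0) :
    ‖f + g‖ ^ p.toReal = ‖f‖ ^ p.toReal + ‖g‖ ^ p.toReal := by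
  rw [lp.norm_rpow_eq_tsum hp, lp.norm_rpow_eq_tsum hp, lp.norm_rpow_eq_tsum hp,
    ← ((lp.memℓp f).summable hp).tsum_add ((lp.memℓp g).summable hp)]
  refine tsum_congr fun i => ?_
  rcases h i with h | h <;> simp [h, hp.ne']

theorem lp.norm_rpow_sum_of_disjoint {p : ℝ≥0∞} (hp : 0 < p.toReal) (s : Finset ℕ)
    (f : ℕ → lp (fun _ : ℕ => ℂ) p) (h : ∀ l m, l ≠ m → ∀ i, f l i = 0 ∨ f m i = 0) :
    ‖∑ l ∈ s, f l‖ ^ p.toReal = ∑ l ∈ s, ‖f l‖ ^ p.toReal := by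
  classical
  induction s using Finset.induction_on with
  | empty => simp [hp.ne']
  | insert a s ha ih =>
    rw [Finset.sum_insert ha, Finset.sum_insert ha, lp.norm_rpow_add_of_disjoint hp, ih]
    intro i
    by_cases hi : f a i = 0
    · exact Or.inl hi
    · right
      rw [lp.coeFn_sum, Finset.sum_apply]
      exact Finset.sum_eq_zero fun m hm =>
        (h a m (fun e => ha (e ▸ hm)) i).resolve_left hi

/-- The unit vector basis of `ℓ_p`, `p < ∞`. -/
noncomputable def lpBasis (p : ℝ≥0∞) [Fact (1 ≤ p)] (hp : p ≠ ∞) :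
    HomogeneousBasis (lp (fun _ : ℕ => ℂ) p) where
  vec i := lp.single p i 1
  coord i := lp.evalCLM ℂ (fun _ : ℕ => ℂ) p i
  coord_vec i j := by
    change lp.single (E := fun _ : ℕ => ℂ) p j 1 i = _
    rw [lp.single_apply, Pi.single_apply]
  norm_vec i := by
    rw [lp.norm_single (zero_lt_one.trans_le Fact.out), norm_one]
  tendsto_sum x := by
    refine (lp.hasSum_single hp x).tendsto_sum_nat.congr fun n => Finset.sum_congr rfl fun i _ => ?_
    rw [← lp.single_smul, smul_eq_mul, mul_one]
    rfl
  norm_sum_le s w z hw hz h := by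
    have hp0 : 0 < p.toReal :=
      ENNReal.toReal_pos (zero_lt_one.trans_le Fact.out).ne' hp
    rw [← Real.rpow_le_rpow_iff (norm_nonneg _) (norm_nonneg _) hp0,
      lp.norm_rpow_sum_of_disjoint hp0 s w hw, lp.norm_rpow_sum_of_disjoint hp0 s z hz]
    exact Finset.sum_le_sum fun l hl => Real.rpow_le_rpow (norm_nonneg _) (h l hl) hp0.le

theorem C0.norm_apply_le (f : C₀(ℕ, ℂ)) (i : ℕ) : ‖f i‖ ≤ ‖f‖ := by
  rw [← ZeroAtInftyContinuousMap.norm_toBCF_eq_norm]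
  exact f.toBCF.norm_coe_le_norm i

theorem C0.norm_le {f : C₀(ℕ, ℂ)} {C : ℝ} (hC : 0 ≤ C) : ‖f‖ ≤ C ↔ ∀ i, ‖f i‖ ≤ C := by
  rw [← ZeroAtInftyContinuousMap.norm_toBCF_eq_norm]
  exact BoundedContinuousFunction.norm_le hC

/-- The evaluation functionals on `c₀`. -/
noncomputable def C0.eval (i : ℕ) : C₀(ℕ, ℂ) →L[ℂ] ℂ :=
  LinearMap.mkContinuous
    { toFun := fun f => f i, map_add' := fun _ _ => rfl, map_smul' := fun _ _ => rfl } 1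
    fun f => by simpa using C0.norm_apply_le f i

/-- The unit vectors of `c₀`. -/
noncomputable def C0.single (i : ℕ) : C₀(ℕ, ℂ) where
  toFun := Pi.single i 1
  zero_at_infty' := by
    rw [cocompact_eq_cofinite]
    refine tendsto_const_nhds.congr' ?_
    filter_upwards [(Set.finite_singleton i).compl_mem_cofinite] with j hj
    simp [show j ≠ i from hj]

theorem C0.single_apply (i j : ℕ) : C0.single i j = if j = i then 1 else 0 := by
  change (Pi.single i 1 : ℕ → ℂ) j = _
  rw [Pi.single_apply]

theorem C0.sum_apply (s : Finset ℕ) (f : ℕ → C₀(ℕ, ℂ)) (i : ℕ) :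
    (∑ l ∈ s, f l) i = ∑ l ∈ s, f l i := map_sum (C0.eval i) f s

/-- The unit vector basis of `c₀`. -/
noncomputable def c0Basis : HomogeneousBasis C₀(ℕ, ℂ) where
  vec := C0.single
  coord := C0.eval
  coord_vec i j := C0.single_apply j i
  norm_vec i := by
    refine le_antisymm ((C0.norm_le zero_le_one).2 fun j => ?_) ?_
    · rw [C0.single_apply]; split_ifs <;> simp
    · simpa [C0.single_apply] using C0.norm_apply_le (C0.single i) i
  tendsto_sum x := by
    rw [Metric.tendsto_atTop]
    intro ε hε
    have hx : Tendsto x atTop (𝓝 0) := by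
      have := x.zero_at_infty'
      rwa [cocompact_eq_cofinite, Nat.cofinite_eq_atTop] at this
    obtain ⟨N, hN⟩ := Metric.tendsto_atTop.1 hx (ε / 2) (half_pos hε)
    refine ⟨N, fun n hn => ?_⟩
    rw [dist_eq_norm]
    refine lt_of_le_of_lt ((C0.norm_le (half_pos hε).le).2 fun i => ?_) (half_lt_self hε)
    have : (∑ l ∈ Finset.range n, C0.eval l x • C0.single l) i = if i < n then x i else 0 := by
      rw [C0.sum_apply]
      simp [C0.single_apply, C0.eval]
    rw [ZeroAtInftyContinuousMap.sub_apply, this]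
    split_ifs with h
    · simpa using (half_pos hε).le
    · simpa using (hN i (by omega)).le
  norm_sum_le s w z hw hz h := by
    have key : ∀ f : ℕ → C₀(ℕ, ℂ), (∀ l m, l ≠ m → ∀ i, f l i = 0 ∨ f m i = 0) →
        ∀ m ∈ s, ∀ i, f m i ≠ 0 → (∑ l ∈ s, f l) i = f m i := fun f hf m hm i hi => by
      rw [C0.sum_apply]
      exact Finset.sum_eq_single_of_mem m hm fun l _ hl => (hf l m hl i).resolve_right hi
    refine (C0.norm_le (norm_nonneg _)).2 fun i => ?_
    by_cases hi : ∃ m ∈ s, w m i ≠ 0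
    · obtain ⟨m, hm, hi⟩ := hi
      rw [key w hw m hm i hi]
      refine (C0.norm_apply_le _ _).trans ((h m hm).trans ((C0.norm_le (norm_nonneg _)).2 fun j => ?_))
      by_cases hj : z m j = 0
      · simp [hj]
      · rw [← key z hz m hm j hj]
        exact C0.norm_apply_le _ _
    · push Not at hi
      rw [C0.sum_apply, Finset.sum_eq_zero hi]
      simp

end SequenceSpaces

/-! ### Set functions, Rosenthal's lemma and dimension bounds -/

section SetFunctions

/-- Rosenthal's lemma, for superadditive set functions: a uniformly bounded sequence of them can be
restricted to an infinite set `A` so that the `n`-th one is small on `A` apart from `n`. In each round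
either one of infinitely many disjoint infinite sets is as desired, or choosing an exceptional point
in each of them gives an infinite set for which the bound has dropped by `ε`. -/
theorem exists_infinite_of_superadditive (v : ℕ → Set ℕ → ℝ) (h0 : ∀ n A, 0 ≤ v n A)
    (hadd : ∀ n A B, Disjoint A B → v n A + v n B ≤ v n (A ∪ B)) {C : ℝ} (hC : ∀ n A, v n A ≤ C)
    {ε : ℝ} (hε : 0 < ε) : ∃ A : Set ℕ, A.Infinite ∧ ∀ n ∈ A, v n (A \ {n}) ≤ ε := by
  have hmono : ∀ n A B, A ⊆ B → v n A ≤ v n B := fun n A B h => by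
    have := hadd n A (B \ A) Set.disjoint_sdiff_right
    rw [Set.union_sdiff_cancel h] at this
    linarith [h0 n (B \ A)]
  have key : ∀ m : ℕ, ∀ N : Set ℕ, N.Infinite → (∀ n ∈ N, v n (N \ {n}) ≤ m * ε) →
      ∃ A : Set ℕ, A.Infinite ∧ ∀ n ∈ A, v n (A \ {n}) ≤ ε := by
    intro m
    induction m with
    | zero => exact fun N hN h => ⟨N, hN, fun n hn => (h n hn).trans (by simpa using hε.le)⟩
    | succ m ih =>
      intro N hN h
      let e := hN.natEmbedding
      have he : Function.Injective fun n => (e n : ℕ) := Subtype.val_injective.comp e.injective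
      let M : ℕ → Set ℕ := fun p => Set.range fun q => (e (Nat.pair p q) : ℕ)
      have hMN : ∀ p, M p ⊆ N := by
        rintro p _ ⟨q, rfl⟩
        exact (e _).2
      have hM : ∀ p q x, x ∈ M p → x ∈ M q → p = q := by
        rintro p q x ⟨a, rfl⟩ ⟨b, hb⟩
        have := he hb
        exact (Nat.pair_eq_pair.1 this).1.symm
      by_cases hp : ∃ p, ∀ n ∈ M p, v n (M p \ {n}) ≤ ε
      · obtain ⟨p, hp⟩ := hp
        refine ⟨M p, Set.infinite_range_of_injective fun a b hab => ?_, hp⟩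
        exact (Nat.pair_eq_pair.1 (he hab)).2
      · push Not at hp
        choose n hn hn' using hp
        have hinj : Function.Injective n := fun p q hpq => hM p q (n p) (hn p) (hpq ▸ hn q)
        refine ih (Set.range n) (Set.infinite_range_of_injective hinj) ?_
        rintro _ ⟨p, rfl⟩
        have hd : Disjoint (Set.range n \ {n p}) (M p \ {n p}) := by
          rw [Set.disjoint_left]
          rintro _ ⟨⟨q, rfl⟩, hq⟩ ⟨hq', -⟩
          exact hq (by rw [hM q p _ (hn q) hq']; rfl)
        have h1 := hadd (n p) _ _ hd
        have h2 : v (n p) (Set.range n \ {n p} ∪ M p \ {n p}) ≤ v (n p) (N \ {n p}) := by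
          refine hmono _ _ _ (Set.union_subset (Set.sdiff_subset_sdiff_left ?_)
            (Set.sdiff_subset_sdiff_left (hMN p)))
          rintro _ ⟨q, rfl⟩
          exact hMN q (hn q)
        have h3 := h (n p) (hMN p (hn p))
        have h4 := hn' p
        push_cast at h3
        linarith
  obtain ⟨m, hm⟩ := exists_nat_ge (C / ε)
  exact key m Set.univ Set.infinite_univ fun n _ =>
    (hC _ _).trans (by rwa [div_le_iff₀ hε] at hm)

/-- A family `v` of monotone subadditive set functions, with supremum `τ`, such that `τ` is
exhaustive: it gets arbitrarily small along every sequence of disjoint sets. -/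
structure ExhaustiveFamily (v : ℕ → Set ℕ → ℝ) (τ : Set ℕ → ℝ) : Prop where
  mono : ∀ k A B, A ⊆ B → v k A ≤ v k B
  union_le : ∀ k A B, v k (A ∪ B) ≤ v k A + v k B
  empty : ∀ k, v k ∅ = 0
  le : ∀ k A, v k A ≤ τ A
  exists_lt : ∀ A r, r < τ A → ∃ k, r < v k A
  exhaustive : ∀ δ > 0, ∀ E : ℕ → Set ℕ, (∀ m n, m < n → Disjoint (E m) (E n)) → ∃ n, τ (E n) ≤ δ

namespace ExhaustiveFamily

variable {v : ℕ → Set ℕ → ℝ} {τ : Set ℕ → ℝ}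

theorem sup_union_le (h : ExhaustiveFamily v τ) (A B : Set ℕ) : τ (A ∪ B) ≤ τ A + τ B := by
  by_contra! hlt
  obtain ⟨k, hk⟩ := h.exists_lt _ _ hlt
  linarith [h.union_le k A B, h.le k A, h.le k B]

theorem sup_mono (h : ExhaustiveFamily v τ) {A B : Set ℕ} (hAB : A ⊆ B) : τ A ≤ τ B := by
  by_contra! hlt
  obtain ⟨k, hk⟩ := h.exists_lt _ _ hlt
  linarith [h.mono k A B hAB, h.le k B]

theorem exists_tail_le (h : ExhaustiveFamily v τ) {B : ℕ → Set ℕ} (hB : Monotone B) {δ : ℝ}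
    (hδ : 0 < δ) : ∃ N, ∀ n ≥ N, τ (B n \ B N) ≤ δ := by
  by_contra! hc
  choose g hg hg' using hc
  let N : ℕ → ℕ := fun i => g^[i] 0
  have hN : ∀ i, N (i + 1) = g (N i) := fun i => Function.iterate_succ_apply' g i 0
  have hNm : Monotone N := monotone_nat_of_le_succ fun i => by rw [hN]; exact hg _
  obtain ⟨i, hi⟩ := h.exhaustive δ hδ (fun i => B (N (i + 1)) \ B (N i)) fun m n hmn => by
    rw [Set.disjoint_left]
    exact fun x hx hx' => hx'.2 (hB (hNm hmn) hx.1)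
  have := hg' (N i)
  rw [← hN] at this
  exact this.not_ge hi

/-- One step of the disjointification in `exists_control`: from a sequence of sets that is null for
each `v k` but not for `τ`, split off a set `E` that is large for `τ`, and such that the sequence, up to
a small loss, still lives off `E`. -/
theorem exists_split (h : ExhaustiveFamily v τ) {A : ℕ → Set ℕ} {δ δ' : ℝ} (hδ : δ < δ')
    (hA : ∀ k, Tendsto (fun n => v k (A n)) atTop (𝓝 0)) (hτ : ∀ n, δ' ≤ τ (A n)) :
    ∃ (E : Set ℕ) (A' : ℕ → Set ℕ), E ⊆ ⋃ n, A n ∧ δ < τ E ∧ (⋃ n, A' n) ⊆ (⋃ n, A n) \ E ∧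
      (∀ k, Tendsto (fun n => v k (A' n)) atTop (𝓝 0)) ∧ ∃ δ'', δ < δ'' ∧ ∀ n, δ'' ≤ τ (A' n) := by
  set γ := (δ' - δ) / 4 with hγ
  have hγ0 : 0 < γ := by rw [hγ]; linarith
  obtain ⟨k, hk⟩ := h.exists_lt (A 0) (δ' - γ) (by linarith [hτ 0])
  obtain ⟨φ, hφ, hφ'⟩ := extraction_forall_of_eventually (P := fun j n => v k (A n) < γ / 2 ^ (j + 1))
    fun j => (hA k).eventually_lt_const (by positivity)
  let B : ℕ → Set ℕ := fun N => ⋃ j ∈ Finset.range N, A (φ j)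
  have hBs : ∀ N, B (N + 1) = B N ∪ A (φ N) := fun N => by
    simp only [B, Finset.mem_range, Set.biUnion_lt_succ]
  have hB : Monotone B := monotone_nat_of_le_succ fun N => by
    rw [hBs]; exact Set.subset_union_left
  have hBv : ∀ N, v k (B N) ≤ γ * (1 - 1 / 2 ^ N) := by
    intro N
    induction N with
    | zero => simp [B, h.empty]
    | succ N ih =>
      rw [hBs]
      have h1 := h.union_le k (B N) (A (φ N))
      have h2 := hφ' N
      have h3 : γ * (1 - 1 / 2 ^ (N + 1)) = γ * (1 - 1 / 2 ^ N) + γ / 2 ^ (N + 1) := by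
        field_simp; ring
      linarith
  obtain ⟨N, hN⟩ := h.exists_tail_le hB hγ0
  have hBA : B N ⊆ ⋃ n, A n := Set.iUnion₂_subset fun j _ => Set.subset_iUnion A (φ j)
  refine ⟨A 0 \ B N, fun n => A (φ (N + n)) ∩ B N,
    Set.sdiff_subset.trans (Set.subset_iUnion A 0), ?_, ?_, fun j => ?_, δ' - γ, by linarith,
    fun n => ?_⟩
  · have h1 := h.union_le k (A 0 \ B N) (B N)
    have h2 := h.mono k (A 0) (A 0 \ B N ∪ B N) (by rw [Set.sdiff_union_self]; exact Set.subset_union_left)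
    have h3 := hBv N
    have h4 : γ * (1 - 1 / 2 ^ N) ≤ γ := mul_le_of_le_one_right hγ0.le (by
      have : (0 : ℝ) < 1 / 2 ^ N := by positivity
      linarith)
    have h5 := h.le k (A 0 \ B N)
    linarith
  · refine Set.iUnion_subset fun n x hx => ⟨hBA hx.2, fun hx' => hx'.2 hx.2⟩
  · refine squeeze_zero (fun n => ?_) (fun n => h.mono j _ _ Set.inter_subset_left)
      ((hA j).comp (hφ.tendsto_atTop.comp (tendsto_add_atTop_nat N |>.congr fun n => add_comm n N)))
    rw [← h.empty j]
    exact h.mono j _ _ (Set.empty_subset _)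
  · have h1 := h.sup_union_le (A (φ (N + n)) ∩ B N) (A (φ (N + n)) \ B N)
    rw [Set.inter_union_sdiff] at h1
    have h2 := hN (N + n + 1) (by omega)
    have h3 : τ (A (φ (N + n)) \ B N) ≤ τ (B (N + n + 1) \ B N) := by
      refine h.sup_mono (Set.sdiff_subset_sdiff_left ?_)
      rw [hBs]
      exact Set.subset_union_right
    linarith [hτ (φ (N + n))]

/-- The supremum of an exhaustive family is controlled, up to `δ`, by finitely many members. -/
theorem exists_control (h : ExhaustiveFamily v τ) {δ : ℝ} (hδ : 0 < δ) :
    ∃ (N : ℕ) (η : ℝ), 0 < η ∧ ∀ A, (∀ k < N, v k A ≤ η) → τ A ≤ δ := by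
  by_contra! hc
  choose A hA hA' using fun N : ℕ => hc N (1 / (N + 1)) (by positivity)
  obtain ⟨δ', hδ', hδ''⟩ : ∃ δ', δ / 2 < δ' ∧ ∀ n, δ' ≤ τ (A n) :=
    ⟨δ, half_lt_self hδ, fun n => (hA' n).le⟩
  have hlim : ∀ k, Tendsto (fun n => v k (A n)) atTop (𝓝 0) := fun k => by
    refine tendsto_of_tendsto_of_tendsto_of_le_of_le' tendsto_const_nhds
      (tendsto_one_div_add_atTop_nhds_zero_nat (𝕜 := ℝ)) (Eventually.of_forall fun n => ?_) ?_
    · rw [← h.empty k]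
      exact h.mono k _ _ (Set.empty_subset _)
    · filter_upwards [eventually_gt_atTop k] with n hn using hA n k hn
  let Q := {A : ℕ → Set ℕ // (∀ k, Tendsto (fun n => v k (A n)) atTop (𝓝 0)) ∧
    ∃ δ', δ / 2 < δ' ∧ ∀ n, δ' ≤ τ (A n)}
  have step : ∀ q : Q, ∃ (E : Set ℕ) (q' : Q), E ⊆ ⋃ n, q.1 n ∧ δ / 2 < τ E ∧
      (⋃ n, q'.1 n) ⊆ (⋃ n, q.1 n) \ E := by
    rintro ⟨A, hA, δ', hδ', hτ⟩
    obtain ⟨E, A', h1, h2, h3, h4, h5⟩ := h.exists_split hδ' hA hτ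
    exact ⟨E, ⟨A', h4, h5⟩, h1, h2, h3⟩
  choose E next hE hEτ hnext using step
  let q : ℕ → Q := fun i => next^[i] ⟨A, hlim, δ', hδ', hδ''⟩
  have hq : ∀ i, q (i + 1) = next (q i) := fun i => Function.iterate_succ_apply' _ _ _
  have hanti : Antitone fun i => ⋃ n, (q i).1 n := antitone_nat_of_succ_le fun i => by
    simp only [hq]
    exact (hnext (q i)).trans Set.sdiff_subset
  obtain ⟨n, hn⟩ := h.exhaustive (δ / 2) (half_pos hδ) (fun i => E (q i)) fun m n hmn => by
    rw [Set.disjoint_right]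
    intro x hx
    have h1 : x ∈ ⋃ j, (q (m + 1)).1 j := hanti (Nat.succ_le_of_lt hmn) (hE _ hx)
    rw [hq] at h1
    exact (hnext _ h1).2
  exact (hEτ (q n)).not_ge hn

end ExhaustiveFamily

/-- A subspace of `L²` of a finite measure `w` on which point evaluations are bounded by
`c ^ (-1/2)` has dimension at most `w(univ) / c`: sum the squares of an orthonormal basis. -/
theorem card_mul_le_sum_of_evaluation_bound {ι κ : Type*} [Fintype ι] [Fintype κ] (Y : κ → ι → ℂ)
    (w : ι → ℝ) (hw : ∀ i, 0 ≤ w i) {c : ℝ}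
    (h : ∀ (a : κ → ℂ) (i : ι), w i ≠ 0 →
      c * ‖∑ k, a k * Y k i‖ ^ 2 ≤ ∑ i, w i * ‖∑ k, a k * Y k i‖ ^ 2)
    (hinj : ∀ a : κ → ℂ, ∑ i, w i * ‖∑ k, a k * Y k i‖ ^ 2 = 0 → a = 0) :
    Fintype.card κ * c ≤ ∑ i, w i := by
  let Φ : (κ → ℂ) →ₗ[ℂ] EuclideanSpace ℂ ι :=
    { toFun := fun a => WithLp.toLp 2 fun i => (√(w i) : ℂ) * ∑ k, a k * Y k i
      map_add' := fun a b => by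
        ext i
        simp [add_mul, mul_add, Finset.sum_add_distrib]
      map_smul' := fun r a => by
        ext i
        simp only [Pi.smul_apply, smul_eq_mul, RingHom.id_apply, PiLp.smul_apply, mul_assoc,
          ← Finset.mul_sum]
        ring }
  have hΦ : ∀ a, ‖Φ a‖ ^ 2 = ∑ i, w i * ‖∑ k, a k * Y k i‖ ^ 2 := fun a => by
    rw [EuclideanSpace.norm_sq_eq]
    refine Finset.sum_congr rfl fun i _ => ?_
    change ‖(√(w i) : ℂ) * ∑ k, a k * Y k i‖ ^ 2 = _
    rw [norm_mul, mul_pow, Complex.norm_real, Real.norm_eq_abs, sq_abs, Real.sq_sqrt (hw i)]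
  have hΦinj : Function.Injective Φ := (injective_iff_map_eq_zero Φ).2 fun a ha =>
    hinj a (by rw [← hΦ, ha, norm_zero]; norm_num)
  have hcard : Module.finrank ℂ (LinearMap.range Φ) = Fintype.card κ := by
    rw [LinearMap.finrank_range_of_inj hΦinj, Module.finrank_fintype_fun_eq_card]
  let b := stdOrthonormalBasis ℂ (LinearMap.range Φ)
  choose a ha using fun m => (b m).2
  have hsub : ∀ y : LinearMap.range Φ, ‖(y : EuclideanSpace ℂ ι)‖ = ‖y‖ := fun _ => rfl
  let g : Fin (Module.finrank ℂ (LinearMap.range Φ)) → ι → ℂ := fun m i => ∑ k, a m k * Y k i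
  have hσ : ∀ i, w i ≠ 0 → c * ∑ m, ‖g m i‖ ^ 2 ≤ 1 := by
    intro i hi
    set σ := ∑ m, ‖g m i‖ ^ 2 with hσ
    have hσ0 : 0 ≤ σ := Finset.sum_nonneg fun m _ => sq_nonneg _
    let a' : κ → ℂ := ∑ m, (starRingEnd ℂ) (g m i) • a m
    have h1 : ∑ k, a' k * Y k i = σ := by
      simp only [a', Finset.sum_apply, Pi.smul_apply, smul_eq_mul, Finset.sum_mul]
      rw [Finset.sum_comm, hσ]
      push_cast
      refine Finset.sum_congr rfl fun m _ => ?_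
      rw [← Complex.conj_mul', Finset.mul_sum]
      exact Finset.sum_congr rfl fun k _ => by ring
    have h2 : ‖Φ a'‖ ^ 2 = σ := by
      have : Φ a' = ((∑ m, (starRingEnd ℂ) (g m i) • b m : LinearMap.range Φ) : EuclideanSpace ℂ ι) := by
        simp only [a', map_sum, map_smul, ha, Submodule.coe_sum, Submodule.coe_smul]
      rw [this, hsub, ← b.sum_sq_norm_inner_right]
      refine Finset.sum_congr rfl fun m _ => ?_
      rw [b.orthonormal.inner_right_fintype, RCLike.norm_conj]
    have h3 := h a' i hi
    rw [← hΦ, h1, h2, Complex.norm_real, Real.norm_eq_abs, sq_abs] at h3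
    rcases hσ0.eq_or_lt with h0 | h0
    · rw [← h0]; norm_num
    · exact le_of_mul_le_mul_right (by linarith [h3, sq σ]) h0
  calc (Fintype.card κ : ℝ) * c = c * ∑ m, ‖Φ (a m)‖ ^ 2 := by
        simp [ha, hsub, b.orthonormal.1, hcard, mul_comm]
    _ = ∑ i, w i * (c * ∑ m, ‖g m i‖ ^ 2) := by
        simp only [hΦ, Finset.mul_sum]
        rw [Finset.sum_comm]
        exact Finset.sum_congr rfl fun i _ => Finset.sum_congr rfl fun m _ => by ring
    _ ≤ ∑ i, w i := Finset.sum_le_sum fun i _ => by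
        by_cases hi : w i = 0
        · simp [hi]
        · exact mul_le_of_le_one_right (hw i) (hσ i hi)

end SetFunctions

/-! ### Operators on `ℓ_∞` that factor the identity -/

/-- The Banach space `ℓ_∞` of bounded complex sequences. -/
abbrev LInfty : Type := lp (fun _ : ℕ => ℂ) ∞

namespace LInfty

/-- The coordinate functionals on `ℓ_∞`. -/
noncomputable def eval (k : ℕ) : LInfty →L[ℂ] ℂ := lp.evalCLM ℂ (fun _ : ℕ => ℂ) ∞ k

@[simp] theorem eval_apply (k : ℕ) (x : LInfty) : eval k x = x k := rfl

theorem norm_apply_le (x : LInfty) (k : ℕ) : ‖x k‖ ≤ ‖x‖ :=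
  lp.norm_apply_le_norm ENNReal.top_ne_zero x k

theorem norm_le {x : LInfty} {C : ℝ} (h : ∀ k, ‖x k‖ ≤ C) : ‖x‖ ≤ C :=
  lp.norm_le_of_forall_le' C h

section ofFunctionals

variable {E : Type*} [NormedAddCommGroup E] [NormedSpace ℂ E]

/-- The operator into `ℓ_∞` whose coordinates are the given uniformly bounded functionals. -/
noncomputable def ofFunctionals (φ : ℕ → E →L[ℂ] ℂ) (C : ℝ) (h : ∀ k x, ‖φ k x‖ ≤ C * ‖x‖) :
    E →L[ℂ] LInfty :=
  LinearMap.mkContinuous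
    { toFun := fun x => ⟨fun k => φ k x, memℓp_infty ⟨C * ‖x‖, by rintro _ ⟨k, rfl⟩; exact h k x⟩⟩
      map_add' := fun x y => by ext k; exact map_add (φ k) x y
      map_smul' := fun c x => by ext k; exact map_smul (φ k) c x } C
    fun x => norm_le fun k => h k x

@[simp] theorem ofFunctionals_apply (φ : ℕ → E →L[ℂ] ℂ) (C : ℝ) (h : ∀ k x, ‖φ k x‖ ≤ C * ‖x‖)
    (x : E) (k : ℕ) : ofFunctionals φ C h x k = φ k x := rfl

end ofFunctionals

open Classical in
/-- The operator of multiplication by the indicator function of `A`. -/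
noncomputable def restrict (A : Set ℕ) : LInfty →L[ℂ] LInfty :=
  ofFunctionals (fun k => if k ∈ A then eval k else 0) 1 fun k x => by
    split_ifs
    · simpa using norm_apply_le x k
    · simp

open Classical in
theorem restrict_apply (A : Set ℕ) (x : LInfty) (k : ℕ) :
    restrict A x k = if k ∈ A then x k else 0 := by
  simp only [restrict, ofFunctionals_apply]
  split_ifs <;> rfl

theorem norm_restrict_apply_le (A : Set ℕ) (x : LInfty) : ‖restrict A x‖ ≤ ‖x‖ := by
  classical
  refine norm_le fun k => ?_
  rw [restrict_apply]
  split_ifs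
  · exact norm_apply_le x k
  · simp

theorem norm_restrict_le (A : Set ℕ) : ‖restrict A‖ ≤ 1 :=
  ContinuousLinearMap.opNorm_le_bound _ zero_le_one fun x => by
    simpa using norm_restrict_apply_le A x

theorem restrict_restrict {A B : Set ℕ} (h : A ⊆ B) (x : LInfty) :
    restrict B (restrict A x) = restrict A x := by
  classical
  ext k
  simp only [restrict_apply]
  split_ifs with h1 h2 h2 <;> first | rfl | exact absurd (h h2) h1

theorem restrict_union {A B : Set ℕ} (h : Disjoint A B) (x : LInfty) :
    restrict (A ∪ B) x = restrict A x + restrict B x := by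
  classical
  ext k
  rw [lp.coeFn_add, Pi.add_apply]
  simp only [restrict_apply, Set.mem_union]
  by_cases hA : k ∈ A
  · simp [hA, Set.disjoint_left.1 h hA]
  · simp [hA]

@[simp] theorem restrict_empty : restrict ∅ = 0 := by
  classical
  ext x k
  simp [restrict_apply]

/-- The variation on `A` of a functional on `ℓ_∞`, viewed as a finitely additive measure. -/
noncomputable def variation (φ : LInfty →L[ℂ] ℂ) (A : Set ℕ) : ℝ := ‖φ.comp (restrict A)‖

theorem variation_nonneg (φ : LInfty →L[ℂ] ℂ) (A : Set ℕ) : 0 ≤ variation φ A := norm_nonneg _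

theorem variation_mono (φ : LInfty →L[ℂ] ℂ) {A B : Set ℕ} (h : A ⊆ B) :
    variation φ A ≤ variation φ B := by
  refine ContinuousLinearMap.opNorm_le_bound _ (norm_nonneg _) fun x => ?_
  calc ‖φ (restrict A x)‖ = ‖φ.comp (restrict B) (restrict A x)‖ := by
        rw [ContinuousLinearMap.comp_apply, restrict_restrict h]
    _ ≤ ‖φ.comp (restrict B)‖ * ‖x‖ :=
        ContinuousLinearMap.le_opNorm_of_le _ (norm_restrict_apply_le A x)

theorem variation_le_norm (φ : LInfty →L[ℂ] ℂ) (A : Set ℕ) : variation φ A ≤ ‖φ‖ :=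
  (ContinuousLinearMap.opNorm_comp_le _ _).trans
    (mul_le_of_le_one_right (norm_nonneg _) (norm_restrict_le A))

@[simp] theorem variation_empty (φ : LInfty →L[ℂ] ℂ) : variation φ ∅ = 0 := by
  simp [variation]

theorem variation_union_le (φ : LInfty →L[ℂ] ℂ) (A B : Set ℕ) :
    variation φ (A ∪ B) ≤ variation φ A + variation φ B := by
  have h : φ.comp (restrict (A ∪ B)) = φ.comp (restrict A) + φ.comp (restrict (B \ A)) := by
    ext x
    rw [← Set.union_sdiff_self, ContinuousLinearMap.comp_apply, restrict_union Set.disjoint_sdiff_right,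
      map_add]
    rfl
  have h1 := norm_add_le (φ.comp (restrict A)) (φ.comp (restrict (B \ A)))
  rw [← h] at h1
  exact h1.trans (add_le_add_right (variation_mono φ Set.sdiff_subset) _)

/-- Superadditivity holds because vectors with disjoint supports in `A` and `B` can be rotated
independently, and their sum stays in the unit ball. -/
theorem variation_add_le (φ : LInfty →L[ℂ] ℂ) {A B : Set ℕ} (h : Disjoint A B) :
    variation φ A + variation φ B ≤ variation φ (A ∪ B) := by
  classical
  have rot : ∀ c : ℂ, ∃ r : ℂ, ‖r‖ = 1 ∧ r * c = ‖c‖ := fun c => by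
    by_cases hc : c = 0
    · exact ⟨1, by simp [hc]⟩
    · have : (‖c‖ : ℂ) ≠ 0 := by simpa using hc
      exact ⟨‖c‖ / c, by rw [norm_div, Complex.norm_real, norm_norm, div_self (by simpa using hc)],
        div_mul_cancel₀ _ hc⟩
  refine le_of_forall_lt fun c hc => ?_
  obtain ⟨a, ha, b, hb, rfl⟩ : ∃ a < variation φ A, ∃ b < variation φ B, a + b = c :=
    ⟨variation φ A - (variation φ A + variation φ B - c) / 2, by linarith,
      variation φ B - (variation φ A + variation φ B - c) / 2, by linarith, by ring⟩
  obtain ⟨x, hx, hx'⟩ := ContinuousLinearMap.exists_lt_apply_of_lt_opNorm _ ha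
  obtain ⟨y, hy, hy'⟩ := ContinuousLinearMap.exists_lt_apply_of_lt_opNorm _ hb
  obtain ⟨r, hr, hr'⟩ := rot (φ (restrict A x))
  obtain ⟨s, hs, hs'⟩ := rot (φ (restrict B y))
  set z := restrict A (r • x) + restrict B (s • y) with hz
  have hz1 : ‖z‖ ≤ 1 := norm_le fun k => by
    rw [hz, lp.coeFn_add, Pi.add_apply, restrict_apply, restrict_apply]
    by_cases hA : k ∈ A
    · simp only [hA, if_true, Set.disjoint_left.1 h hA, if_false, add_zero]
      simpa [hr] using (norm_apply_le x k).trans hx.le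
    · simp only [hA, if_false, zero_add]
      split_ifs
      · simpa [hs] using (norm_apply_le y k).trans hy.le
      · simp
  have hz2 : restrict (A ∪ B) z = z := by
    rw [hz, map_add, restrict_restrict Set.subset_union_left,
      restrict_restrict Set.subset_union_right]
  have hz3 : φ z = ((‖φ (restrict A x)‖ + ‖φ (restrict B y)‖ : ℝ) : ℂ) := by
    rw [hz, map_add, map_smul, map_smul, map_smul, map_smul, smul_eq_mul, smul_eq_mul, hr', hs']
    push_cast
    rfl
  have h1 : ‖φ z‖ ≤ variation φ (A ∪ B) := by
    have := (φ.comp (restrict (A ∪ B))).le_opNorm_of_le hz1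
    rwa [ContinuousLinearMap.comp_apply, hz2, mul_one] at this
  rw [hz3, Complex.norm_real, Real.norm_of_nonneg (by positivity)] at h1
  simp only [ContinuousLinearMap.comp_apply] at hx' hy'
  linarith

theorem variation_union (φ : LInfty →L[ℂ] ℂ) {A B : Set ℕ} (h : Disjoint A B) :
    variation φ (A ∪ B) = variation φ A + variation φ B :=
  le_antisymm (variation_union_le φ A B) (variation_add_le φ h)

/-- An operator on `ℓ_∞` that does not tend to zero along some disjoint sequence of sets factors the
identity: by Rosenthal's lemma, `T` is diagonally dominant on a subsequence of disjointly supported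
vectors. -/
theorem exists_factorization (T : LInfty →L[ℂ] LInfty) {δ : ℝ} (hδ : 0 < δ) (E : ℕ → Set ℕ)
    (hE : ∀ m n, m < n → Disjoint (E m) (E n)) (hT : ∀ n, δ < ‖T.comp (restrict (E n))‖) :
    ∃ A C : LInfty →L[ℂ] LInfty, A * T * C = 1 := by
  classical
  have hE' : ∀ m n s, s ∈ E m → s ∈ E n → m = n := fun m n s hm hn => by
    by_contra h
    rcases Ne.lt_or_gt h with h | h
    · exact Set.disjoint_left.1 (hE m n h) hm hn
    · exact Set.disjoint_left.1 (hE n m h) hn hm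
  have hx : ∀ n, ∃ (x : LInfty) (k : ℕ), ‖x‖ ≤ 1 ∧ δ < ‖T (restrict (E n) x) k‖ := fun n => by
    obtain ⟨x, hx, hx'⟩ := ContinuousLinearMap.exists_lt_apply_of_lt_opNorm _ (hT n)
    by_contra! h
    exact hx'.not_ge (norm_le fun k => h x k hx.le)
  choose x k hx hk using hx
  let U : LInfty →L[ℂ] LInfty := ofFunctionals
    (fun s => if h : ∃ n, s ∈ E n then x h.choose s • eval h.choose else 0) 1 fun s a => by
      split_ifs with h
      · rw [smul_apply, norm_smul]
        exact mul_le_mul ((norm_apply_le _ _).trans (hx _)) (norm_apply_le a _) (norm_nonneg _)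
          zero_le_one
      · simp
  have hU : ∀ n s a, s ∈ E n → U a s = x n s * a n := fun n s a hs => by
    have h : ∃ n, s ∈ E n := ⟨n, hs⟩
    have hn : h.choose = n := hE' _ _ s h.choose_spec hs
    simp only [U, ofFunctionals_apply, dif_pos h, hn]
    rfl
  have hU' : ∀ s a, (¬ ∃ n, s ∈ E n) → U a s = 0 := fun s a h => by
    simp only [U, ofFunctionals_apply, dif_neg h]
    rfl
  let φ : ℕ → LInfty →L[ℂ] ℂ := fun n => (eval (k n)).comp (T.comp U)
  have hφ : ∀ n, ‖φ n‖ ≤ ‖T.comp U‖ := fun n =>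
    ContinuousLinearMap.opNorm_le_bound _ (norm_nonneg _) fun a =>
      (norm_apply_le _ _).trans ((T.comp U).le_opNorm a)
  obtain ⟨A, hA, hA'⟩ := exists_infinite_of_superadditive (fun n => variation (φ n))
    (fun n => variation_nonneg (φ n)) (fun n _ _ h => variation_add_le (φ n) h)
    (fun n S => (variation_le_norm (φ n) S).trans (hφ n)) (half_pos hδ)
  let e := hA.natEmbedding
  have he : ∀ i j, (e i : ℕ) = e j → i = j := fun i j h => e.injective (Subtype.ext h)
  let V : LInfty →L[ℂ] LInfty := ofFunctionals
    (fun s => if h : ∃ i, (e i : ℕ) = s then eval h.choose else 0) 1 fun s a => by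
      split_ifs with h
      · simpa using norm_apply_le a _
      · simp
  have hV : ∀ i a, V a (e i) = a i := fun i a => by
    have h : ∃ j, (e j : ℕ) = e i := ⟨i, rfl⟩
    have hi : h.choose = i := he _ _ h.choose_spec
    simp only [V, ofFunctionals_apply, dif_pos h, hi, eval_apply]
  have hV' : ∀ s a, s ∉ A → V a s = 0 := fun s a hs => by
    have h : ¬ ∃ j, (e j : ℕ) = s := by
      rintro ⟨j, rfl⟩
      exact hs (e j).2
    simp only [V, ofFunctionals_apply, dif_neg h]
    rfl
  have hVnorm : ∀ a, ‖V a‖ ≤ ‖a‖ := fun a => norm_le fun s => by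
    by_cases h : ∃ j, (e j : ℕ) = s
    · obtain ⟨j, rfl⟩ := h
      rw [hV]
      exact norm_apply_le a j
    · simp only [V, ofFunctionals_apply, dif_neg h]
      simp
  -- the diagonal entries
  let c : ℕ → ℂ := fun n => T (restrict (E n) (x n)) (k n)
  have hc : ∀ n, δ < ‖c n‖ := hk
  have hc0 : ∀ n, c n ≠ 0 := fun n => norm_pos_iff.1 (hδ.trans (hc n))
  have hcinv : ∀ n, ‖(c n)⁻¹‖ ≤ δ⁻¹ := fun n => by
    rw [norm_inv]
    exact inv_anti₀ hδ (hc n).le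
  let R : LInfty →L[ℂ] LInfty := ofFunctionals
    (fun i => (c (e i))⁻¹ • eval (k (e i))) δ⁻¹ fun i a => by
      rw [smul_apply, norm_smul]
      exact mul_le_mul (hcinv _) (norm_apply_le a _) (norm_nonneg _) (by positivity)
  have hdiag : ∀ n, ∀ r : ℂ, U (lp.single ∞ n r) = r • restrict (E n) (x n) := fun n r => by
    ext s
    rw [lp.coeFn_smul, Pi.smul_apply, restrict_apply]
    by_cases h : ∃ m, s ∈ E m
    · obtain ⟨m, hm⟩ := h
      rw [hU m s _ hm, lp.single_apply, Pi.single_apply]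
      by_cases hmn : m = n
      · subst hmn
        simp [hm, mul_comm]
      · have : s ∉ E n := fun h => hmn (hE' _ _ s hm h)
        simp [this, hmn]
    · rw [hU' s _ h, if_neg fun h' => h ⟨n, h'⟩, smul_zero]
  have hsplit : ∀ i a, V a = lp.single ∞ (e i : ℕ) (a i) + restrict (A \ {(e i : ℕ)}) (V a) := by
    intro i a
    ext s
    rw [lp.coeFn_add, Pi.add_apply, restrict_apply, lp.single_apply, Pi.single_apply]
    by_cases hs : s = e i
    · subst hs
      simp [hV]
    · by_cases hsA : s ∈ A
      · simp [hs, hsA]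
      · simp [hs, hsA, hV' s a hsA]
  have hnorm : ‖1 - R * T * (U * V)‖ < 1 := by
    refine (ContinuousLinearMap.opNorm_le_bound _ (by norm_num : (0 : ℝ) ≤ 1 / 2)
      fun a => norm_le fun i => ?_).trans_lt (by norm_num)
    have h1 : (R * T * (U * V)) a i = (c (e i))⁻¹ * φ (e i) (V a) := rfl
    have h2 : φ (e i) (V a) = a i * c (e i) + φ (e i) (restrict (A \ {(e i : ℕ)}) (V a)) := by
      conv_lhs => rw [hsplit i a]
      rw [map_add]
      congr 1
      simp only [φ, ContinuousLinearMap.comp_apply, hdiag, map_smul, eval_apply, smul_eq_mul, c]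
    have h3 : (1 - R * T * (U * V)) a i =
        -((c (e i))⁻¹ * φ (e i) (restrict (A \ {(e i : ℕ)}) (V a))) := by
      rw [sub_apply, lp.coeFn_sub, Pi.sub_apply, h1, h2]
      simp only [one_apply_eq_self]
      field_simp [hc0 (e i)]
      ring
    rw [h3, norm_neg, norm_mul]
    have h4 : ‖φ (e i) (restrict (A \ {(e i : ℕ)}) (V a))‖ ≤ δ / 2 * ‖a‖ :=
      (((φ (e i)).comp (restrict _)).le_opNorm_of_le (hVnorm a)).trans
        (mul_le_mul_of_nonneg_right (hA' _ (e i).2) (norm_nonneg _))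
    calc _ ≤ δ⁻¹ * (δ / 2 * ‖a‖) := by gcongr; exact hcinv _
      _ = _ := by field_simp
  obtain ⟨W, hW⟩ := isUnit_one_sub_of_norm_lt_one hnorm
  rw [sub_sub_cancel] at hW
  exact ⟨↑W⁻¹ * R, U * V, by
    rw [mul_assoc, mul_assoc, ← mul_assoc R, ← hW, Units.inv_mul]⟩

theorem exists_two_copies :
    ∃ A C : Fin 2 → LInfty →L[ℂ] LInfty, ∀ i j, A i * C j = if i = j then 1 else 0 := by
  refine ⟨fun i => ofFunctionals (fun k => eval (2 * k + i)) 1 fun k x => by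
      simpa using norm_apply_le x _,
    fun j => ofFunctionals (fun s => if s % 2 = j then eval (s / 2) else 0) 1 fun s x => ?_,
    fun i j => ?_⟩
  · split_ifs
    · simpa using norm_apply_le x _
    · simp
  · ext x k
    rw [mul_apply_eq_comp, ofFunctionals_apply, eval_apply, ofFunctionals_apply]
    have h1 : (2 * k + (i : ℕ)) % 2 = i := by omega
    have h2 : (2 * k + (i : ℕ)) / 2 = k := by omega
    rw [h1, h2]
    by_cases hij : i = j
    · simp [hij]
    · have : ¬ (i : ℕ) = j := fun h => hij (Fin.ext h)
      simp [hij, this]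

end LInfty

/-! ### Exhaustive operators on `ℓ_∞` -/

namespace LInfty

theorem exhaustiveFamily (T : LInfty →L[ℂ] LInfty)
    (hT : ∀ δ > 0, ∀ E : ℕ → Set ℕ, (∀ m n, m < n → Disjoint (E m) (E n)) →
      ∃ n, ‖T.comp (restrict (E n))‖ ≤ δ) :
    ExhaustiveFamily (fun k => variation ((eval k).comp T)) (fun A => ‖T.comp (restrict A)‖) where
  mono k _ _ h := variation_mono _ h
  union_le k A B := variation_union_le _ A B
  empty k := variation_empty _
  le k A := ContinuousLinearMap.opNorm_le_bound _ (norm_nonneg _) fun x =>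
    (norm_apply_le _ k).trans ((T.comp (restrict A)).le_opNorm x)
  exists_lt A r hr := by
    obtain ⟨x, hx, hx'⟩ := ContinuousLinearMap.exists_lt_apply_of_lt_opNorm _ hr
    by_contra! h
    refine hx'.not_ge (norm_le fun k => ?_)
    have := (((eval k).comp T).comp (restrict A)).le_opNorm_of_le hx.le
    rw [mul_one] at this
    exact this.trans (h k)
  exhaustive := hT

theorem sum_variation_preimage {ι : Type*} (φ : LInfty →L[ℂ] ℂ) (j : ℕ → ι) (S : Finset ι) :
    ∑ i ∈ S, variation φ (j ⁻¹' {i}) = variation φ (j ⁻¹' S) := by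
  classical
  induction S using Finset.induction_on with
  | empty => simp
  | insert a S ha ih =>
    rw [Finset.sum_insert ha, ih, ← variation_union]
    · congr 1
      ext s
      simp
    · rw [Set.disjoint_left]
      intro s hs hs'
      rw [Set.mem_preimage, Set.mem_singleton_iff] at hs
      rw [Set.mem_preimage, hs] at hs'
      exact ha hs'

/-- For an exhaustive operator `T`, there is a bound on the dimension of the spaces of step functions
on which `T` is close to the identity. Such a function exceeds a fixed fraction `t` of its norm on a
set that is not small for the controlling measure, so its sup norm is dominated by its `L²` norm. -/
theorem exists_bound_of_step (T : LInfty →L[ℂ] LInfty)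
    (hT : ExhaustiveFamily (fun k => variation ((eval k).comp T))
      (fun A => ‖T.comp (restrict A)‖)) :
    ∃ C : ℝ, ∀ (n : ℕ) (ι : Type) [Fintype ι] (j : ℕ → ι) (Y : Fin n → ι → ℂ) (x : Fin n → LInfty),
      (∀ m s, x m s = Y m (j s)) →
      (∀ a : Fin n → ℂ, ‖∑ m, a m • x m - T (∑ m, a m • x m)‖ ≤ 1 / 4 * ‖∑ m, a m • x m‖) →
      (∀ a : Fin n → ℂ, ∑ m, a m • x m = 0 → a = 0) → (n : ℝ) ≤ C := by
  classical
  obtain ⟨N, η, hη, hctrl⟩ := hT.exists_control (show (0 : ℝ) < 1 / 4 by norm_num)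
  set t : ℝ := 1 / (4 * (‖T‖ + 1)) with ht
  have ht0 : 0 < t := by positivity
  have hTt : ‖T‖ * t ≤ 1 / 4 := by
    rw [ht, mul_one_div, div_le_div_iff₀ (by positivity) (by norm_num)]
    linarith
  let μ : Set ℕ → ℝ := fun A => ∑ k ∈ Finset.range N, variation ((eval k).comp T) A
  have hμ : ∀ A, μ A ≤ η → ‖T.comp (restrict A)‖ ≤ 1 / 4 := fun A hA =>
    hctrl A fun k hk => (Finset.single_le_sum
      (f := fun k => variation ((eval k).comp T) A) (fun _ _ => variation_nonneg _ _)
      (Finset.mem_range.2 hk)).trans hA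
  refine ⟨μ Set.univ / (η * t ^ 2), fun n ι _ j Y x hx hxT hinj => ?_⟩
  let w : ι → ℝ := fun i => μ (j ⁻¹' {i})
  have hw : ∀ S : Finset ι, ∑ i ∈ S, w i = μ (j ⁻¹' S) := fun S => by
    simp only [w, μ]
    rw [Finset.sum_comm]
    exact Finset.sum_congr rfl fun k _ => sum_variation_preimage _ j S
  have hw0 : ∀ i, 0 ≤ w i := fun i => Finset.sum_nonneg fun _ _ => variation_nonneg _ _
  have hxs : ∀ (a : Fin n → ℂ) s, (∑ m, a m • x m : LInfty) s = ∑ m, a m * Y m (j s) := by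
    intro a s
    rw [lp.coeFn_sum, Finset.sum_apply]
    exact Finset.sum_congr rfl fun m _ => by
      rw [lp.coeFn_smul, Pi.smul_apply, smul_eq_mul, hx]
  have key : ∀ a : Fin n → ℂ, η * t ^ 2 * ‖∑ m, a m • x m‖ ^ 2 ≤
      ∑ i, w i * ‖∑ m, a m * Y m i‖ ^ 2 := by
    intro a
    set z := ∑ m, a m • x m with hz
    let G : ι → ℂ := fun i => ∑ m, a m * Y m i
    have hzG : ∀ s, z s = G (j s) := hxs a
    rcases eq_or_ne z 0 with h0 | h0
    · rw [h0, norm_zero]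
      simpa using Finset.sum_nonneg fun i _ => mul_nonneg (hw0 i) (sq_nonneg _)
    have hz0 : 0 < ‖z‖ := norm_pos_iff.2 h0
    let S : Finset ι := Finset.univ.filter fun i => t * ‖z‖ < ‖G i‖
    have hS : η < μ (j ⁻¹' S) := by
      by_contra! hle
      have h1 : ‖T (restrict (j ⁻¹' S) z)‖ ≤ 1 / 4 * ‖z‖ :=
        (T.comp (restrict (j ⁻¹' S))).le_of_opNorm_le (hμ _ hle) z
      have h2 : ‖restrict (j ⁻¹' S)ᶜ z‖ ≤ t * ‖z‖ := norm_le fun s => by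
        rw [restrict_apply]
        split_ifs with hs
        · rw [hzG]
          simpa [S] using hs
        · simpa using mul_nonneg ht0.le hz0.le
      have h3 : ‖T (restrict (j ⁻¹' S)ᶜ z)‖ ≤ 1 / 4 * ‖z‖ :=
        calc _ ≤ ‖T‖ * (t * ‖z‖) := T.le_opNorm_of_le h2
          _ = ‖T‖ * t * ‖z‖ := by ring
          _ ≤ _ := by gcongr
      have h4 : z = restrict (j ⁻¹' S) z + restrict (j ⁻¹' S)ᶜ z := by
        rw [← restrict_union disjoint_compl_right, Set.union_compl_self]
        ext s
        simp [restrict_apply]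
      have h5 : ‖T z‖ ≤ 1 / 4 * ‖z‖ + 1 / 4 * ‖z‖ := by
        conv_lhs => rw [h4, map_add]
        exact (norm_add_le _ _).trans (add_le_add h1 h3)
      have h6 := hxT a
      have h7 := norm_sub_norm_le z (T z)
      linarith
    calc η * t ^ 2 * ‖z‖ ^ 2 ≤ μ (j ⁻¹' S) * (t * ‖z‖) ^ 2 := by
          rw [mul_pow, ← mul_assoc]
          gcongr
      _ = ∑ i ∈ S, w i * (t * ‖z‖) ^ 2 := by rw [← hw, Finset.sum_mul]
      _ ≤ ∑ i ∈ S, w i * ‖G i‖ ^ 2 := Finset.sum_le_sum fun i hi => by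
          have := (Finset.mem_filter.1 hi).2
          have h0 := hw0 i
          gcongr
      _ ≤ ∑ i, w i * ‖G i‖ ^ 2 := Finset.sum_le_sum_of_subset_of_nonneg (Finset.subset_univ _)
          fun i _ _ => mul_nonneg (hw0 i) (sq_nonneg _)
  have hc : 0 < η * t ^ 2 := by positivity
  have hbound := card_mul_le_sum_of_evaluation_bound Y w hw0 (c := η * t ^ 2)
    (fun a i hi => by
      obtain ⟨s, rfl⟩ : ∃ s, j s = i := by
        by_contra! h
        refine hi ?_
        have : j ⁻¹' {i} = ∅ := by
          ext s
          simpa using h s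
        simp [w, μ, this]
      refine le_trans ?_ (key a)
      rw [← hxs]
      gcongr
      exact norm_apply_le _ s)
    (fun a ha => hinj a (by
      have h1 := key a
      rw [ha] at h1
      have h2 : ‖∑ m, a m • x m‖ ^ 2 ≤ 0 := nonpos_of_mul_nonpos_right h1 hc
      exact norm_eq_zero.1 (pow_eq_zero_iff two_ne_zero |>.1 (le_antisymm h2 (sq_nonneg _)))))
  have huniv : ∑ i, w i = μ Set.univ := by
    rw [hw]
    simp
  rw [Fintype.card_fin, huniv] at hbound
  rwa [le_div_iff₀ hc]

/-- A finite family in `ℓ_∞` is approximated by step functions on a common finite partition. -/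
theorem exists_step_approx {n : ℕ} (x : Fin n → LInfty) {ε : ℝ} (hε : 0 < ε) :
    ∃ (ι : Type) (_ : Fintype ι) (j : ℕ → ι) (Y : Fin n → ι → ℂ) (z : Fin n → LInfty),
      (∀ m s, z m s = Y m (j s)) ∧ ∀ m, ‖x m - z m‖ ≤ ε := by
  let F : ℕ → Fin n → ℂ := fun s m => x m s
  have hF : TotallyBounded (Set.range F) := by
    refine (isCompact_closedBall (0 : Fin n → ℂ) (∑ m, ‖x m‖)).totallyBounded.subset ?_
    rintro _ ⟨s, rfl⟩
    rw [mem_closedBall_zero_iff, pi_norm_le_iff_of_nonneg (by positivity)]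
    exact fun m => (norm_apply_le (x m) s).trans
      (Finset.single_le_sum (f := fun m => ‖x m‖) (fun _ _ => norm_nonneg _) (Finset.mem_univ m))
  obtain ⟨t, ht, hcov⟩ := Metric.totallyBounded_iff.1 hF ε hε
  have hj : ∀ s, ∃ y : t, dist (F s) y < ε := fun s => by
    obtain ⟨y, hy, hsy⟩ := Set.mem_iUnion₂.1 (hcov ⟨s, rfl⟩)
    exact ⟨⟨y, hy⟩, hsy⟩
  choose j hj using hj
  have hmem : ∀ m, Memℓp (fun s => (j s : Fin n → ℂ) m : ∀ _ : ℕ, ℂ) ∞ := fun m => by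
    have : Finite t := ht
    refine memℓp_infty (Set.Finite.bddAbove ?_)
    exact (Set.finite_range fun y : t => ‖(y : Fin n → ℂ) m‖).subset (by
      rintro _ ⟨s, rfl⟩
      exact ⟨j s, rfl⟩)
  refine ⟨t, ht.fintype, j, fun m y => (y : Fin n → ℂ) m, fun m => ⟨_, hmem m⟩, fun _ _ => rfl,
    fun m => norm_le fun s => ?_⟩
  have := (dist_le_pi_dist _ _ m).trans (hj s).le
  rwa [dist_eq_norm] at this

/-- For an exhaustive operator `T`, there is a bound on the length of the families, with coefficients
controlled by the norm, that consist of almost fixed vectors of `T`. -/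
theorem exists_bound_of_almost_fixed (T : LInfty →L[ℂ] LInfty)
    (hT : ExhaustiveFamily (fun k => variation ((eval k).comp T))
      (fun A => ‖T.comp (restrict A)‖)) :
    ∃ C : ℝ, ∀ (n : ℕ) (M : ℝ), 0 < M → ∃ η > 0, ∀ x : Fin n → LInfty,
      (∀ a : Fin n → ℂ, ∑ m, ‖a m‖ ≤ M * ‖∑ m, a m • x m‖) →
      (∀ m, ‖x m - T (x m)‖ ≤ η) → (n : ℝ) ≤ C := by
  obtain ⟨C, hC⟩ := exists_bound_of_step T hT
  refine ⟨C, fun n M hM => ⟨1 / (16 * M), by positivity, fun x hx hxT => ?_⟩⟩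
  have hε : 0 < 1 / (16 * M * (1 + ‖T‖)) := by positivity
  set ε := 1 / (16 * M * (1 + ‖T‖)) with hεdef
  obtain ⟨ι, _, j, Y, z, hzY, hz⟩ := exists_step_approx x hε
  have small : ∀ (a : Fin n → ℂ) (y : Fin n → LInfty) (r : ℝ), (∀ m, ‖y m‖ ≤ r) → 0 ≤ r →
      ‖∑ m, a m • y m‖ ≤ r * (M * ‖∑ m, a m • x m‖) := fun a y r hy hr =>
    calc _ ≤ ∑ m, ‖a m‖ * r := norm_sum_le_of_le _ fun m _ => by
          rw [norm_smul]
          exact mul_le_mul_of_nonneg_left (hy m) (norm_nonneg _)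
      _ = r * ∑ m, ‖a m‖ := by rw [← Finset.sum_mul, mul_comm]
      _ ≤ _ := mul_le_mul_of_nonneg_left (hx a) hr
  have est : ∀ a : Fin n → ℂ, ‖∑ m, a m • x m‖ ≤ 2 * ‖∑ m, a m • z m‖ ∧
      ‖∑ m, a m • z m - T (∑ m, a m • z m)‖ ≤ 1 / 8 * ‖∑ m, a m • x m‖ := by
    intro a
    have h1 := small a (fun m => x m - z m) ε hz hε.le
    have h2 := small a (fun m => x m - T (x m)) _ hxT (by positivity)
    set X := ∑ m, a m • x m with hX
    set Z := ∑ m, a m • z m with hZ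
    rw [show ∑ m, a m • (x m - z m) = X - Z by simp [smul_sub, hX, hZ]] at h1
    rw [show ∑ m, a m • (x m - T (x m)) = X - T X by simp [smul_sub, hX, map_sum]] at h2
    have h3 : (1 + ‖T‖) * (ε * (M * ‖X‖)) = ‖X‖ / 16 := by
      rw [hεdef]
      have := norm_nonneg T
      field_simp
    have h4 : 1 / (16 * M) * (M * ‖X‖) = ‖X‖ / 16 := by field_simp
    have h5 : ‖T (X - Z)‖ ≤ ‖T‖ * ‖X - Z‖ := T.le_opNorm _
    have h6 : ‖X - Z‖ + ‖T‖ * ‖X - Z‖ ≤ ‖X‖ / 16 := by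
      rw [← h3, ← one_add_mul]
      exact mul_le_mul_of_nonneg_left h1 (by positivity)
    have h7 : 0 ≤ ‖T‖ * ‖X - Z‖ := by positivity
    have h8 := norm_sub_norm_le X Z
    constructor
    · linarith [norm_nonneg X]
    · rw [show Z - T Z = (X - T X) - (X - Z) + T (X - Z) by rw [map_sub]; abel]
      have h9 := norm_add_le (X - T X - (X - Z)) (T (X - Z))
      have h10 := norm_sub_le (X - T X) (X - Z)
      linarith
  refine hC n ι j Y z hzY (fun a => ?_) fun a ha => ?_
  · have := est a
    linarith [this.1, this.2]
  · have h1 := (est a).1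
    rw [ha, norm_zero, mul_zero] at h1
    have h2 := hx a
    rw [le_antisymm h1 (norm_nonneg _), mul_zero] at h2
    funext m
    have h3 := (Finset.single_le_sum (f := fun m => ‖a m‖) (fun _ _ => norm_nonneg _)
      (Finset.mem_univ m)).trans h2
    exact norm_le_zero_iff.1 h3

/-- An operator on a normed space into `ℓ_∞` which is bounded below on a subspace `Z` has a left
inverse there, because `ℓ_∞` is injective: extend the coordinates by the Hahn–Banach theorem. -/
theorem exists_leftInverse {E : Type*} [NormedAddCommGroup E] [NormedSpace ℂ E]
    (S : LInfty →L[ℂ] E) (Z : Submodule ℂ LInfty) {η : ℝ} (hη : 0 < η)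
    (hS : ∀ x ∈ Z, η * ‖x‖ ≤ ‖S x‖) : ∃ R : E →L[ℂ] LInfty, ∀ x ∈ Z, R (S x) = x := by
  let L : Z →ₗ[ℂ] E := (S : LInfty →ₗ[ℂ] E).comp Z.subtype
  have hL : ∀ x : Z, η * ‖x‖ ≤ ‖L x‖ := fun x => hS x x.2
  have hinj : Function.Injective L := (injective_iff_map_eq_zero L).2 fun x hx => by
    have := hL x
    rw [hx, norm_zero] at this
    exact norm_le_zero_iff.1 (nonpos_of_mul_nonpos_right this hη)
  let e := LinearEquiv.ofInjective L hinj
  have he : ∀ y : LinearMap.range L, ‖e.symm y‖ ≤ η⁻¹ * ‖y‖ := fun y => by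
    have h1 := hL (e.symm y)
    have h2 : L (e.symm y) = y := congrArg Subtype.val (e.apply_symm_apply y)
    rw [h2] at h1
    rw [le_inv_mul_iff₀ hη]
    exact h1
  let f : ℕ → LinearMap.range L →L[ℂ] ℂ := fun k =>
    LinearMap.mkContinuous
      ((eval k : LInfty →ₗ[ℂ] ℂ).comp (Z.subtype.comp (e.symm : LinearMap.range L →ₗ[ℂ] Z))) η⁻¹
      fun y => (norm_apply_le _ k).trans (he y)
  have hf : ∀ k, ‖f k‖ ≤ η⁻¹ := fun k => LinearMap.mkContinuous_norm_le _ (by positivity) _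
  choose g hg hg' using fun k => exists_extension_norm_eq (LinearMap.range L) (f k)
  refine ⟨ofFunctionals g η⁻¹ fun k x => (g k).le_of_opNorm_le ((hg' k).trans_le (hf k)) x,
    fun x hx => ?_⟩
  ext k
  rw [ofFunctionals_apply]
  have h1 := hg k ⟨L ⟨x, hx⟩, ⟨_, rfl⟩⟩
  have h2 : e.symm ⟨L ⟨x, hx⟩, ⟨_, rfl⟩⟩ = ⟨x, hx⟩ := e.symm_apply_apply ⟨x, hx⟩
  refine h1.trans ?_
  change ((e.symm ⟨L ⟨x, hx⟩, ⟨_, rfl⟩⟩ : Z) : LInfty) k = x k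
  rw [h2]

/-- Coefficients of a linear combination of a triangular sequence are controlled by its norm. -/
theorem sum_norm_le_of_triangular {E : Type*} [NormedAddCommGroup E] [NormedSpace ℂ E]
    (x : ℕ → E) (f : ℕ → E →L[ℂ] ℂ) (hx : ∀ i, ‖x i‖ = 1) (hf : ∀ i, ‖f i‖ ≤ 1)
    (hfx : ∀ i, f i (x i) = 1) (hlt : ∀ i j, i < j → f i (x j) = 0) (n : ℕ) (a : Fin n → ℂ) :
    ∑ m, ‖a m‖ ≤ 2 ^ n * ‖∑ m, a m • x m‖ := by
  let b : ℕ → ℂ := fun l => if h : l < n then a ⟨l, h⟩ else 0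
  have hb : ∀ m : Fin n, a m = b m := fun m => by simp [b]
  simp only [hb]
  rw [Fin.sum_univ_eq_sum_range (fun l => ‖b l‖), Fin.sum_univ_eq_sum_range (fun l => b l • x l)]
  set S := ∑ l ∈ Finset.range n, b l • x l with hS
  have key : ∀ i ≤ n, ∑ l ∈ Finset.range i, ‖b l‖ ≤ (2 ^ i - 1) * ‖S‖ := by
    intro i
    induction i with
    | zero => simp
    | succ i ih =>
      intro hi
      have ih := ih (by omega)
      have h1 : f i S = (∑ l ∈ Finset.range i, b l * f i (x l)) + b i := by
        rw [hS, map_sum, ← Finset.sum_subset (Finset.range_mono hi)]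
        · rw [Finset.sum_range_succ]
          simp [hfx]
        · intro l _ hl
          rw [map_smul, hlt i l (by simpa using hl), smul_zero]
      have h2 : ‖∑ l ∈ Finset.range i, b l * f i (x l)‖ ≤ ∑ l ∈ Finset.range i, ‖b l‖ :=
        norm_sum_le_of_le _ fun l _ => by
          rw [norm_mul]
          refine mul_le_of_le_one_right (norm_nonneg _) ?_
          simpa using (f i).le_of_opNorm_le_of_le (hf i) (hx l).le
      have h3 : ‖f i S‖ ≤ ‖S‖ := by simpa using (f i).le_of_opNorm_le (hf i) S
      have h4 : ‖b i‖ ≤ ‖f i S‖ + ‖∑ l ∈ Finset.range i, b l * f i (x l)‖ := by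
        rw [show b i = f i S - ∑ l ∈ Finset.range i, b l * f i (x l) by rw [h1]; ring]
        exact norm_sub_le _ _
      rw [Finset.sum_range_succ]
      calc _ ≤ (2 ^ i - 1) * ‖S‖ + (‖S‖ + (2 ^ i - 1) * ‖S‖) := by linarith
        _ = _ := by ring
  refine (key n le_rfl).trans (mul_le_mul_of_nonneg_right ?_ (norm_nonneg _))
  linarith

/-- If `T` is exhaustive, then `1 - T` is left invertible modulo the finite-rank operators. -/
theorem exists_leftInverse_mod_finiteRank (T : LInfty →L[ℂ] LInfty)
    (hT : ExhaustiveFamily (fun k => variation ((eval k).comp T))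
      (fun A => ‖T.comp (restrict A)‖)) :
    ∃ R : LInfty →L[ℂ] LInfty, FiniteDimensional ℂ (R * (1 - T) - 1).range := by
  classical
  obtain ⟨C, hC⟩ := exists_bound_of_almost_fixed T hT
  obtain ⟨n, hn⟩ := exists_nat_gt C
  obtain ⟨η, hη, hn'⟩ := hC n (2 ^ n) (by positivity)
  -- `1 - T` is bounded below by `η` on a finite intersection of kernels of functionals, since
  -- otherwise a triangular sequence of almost fixed vectors exceeds the dimension bound
  obtain ⟨s, hs⟩ : ∃ s : Finset (LInfty →L[ℂ] ℂ), ∀ x, (∀ f ∈ s, f x = 0) →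
      η * ‖x‖ ≤ ‖(1 - T) x‖ := by
    by_contra! hcon
    have hseq := exists_seq_of_forall_finset_exists
      (fun p : LInfty × (LInfty →L[ℂ] ℂ) => ‖p.1‖ = 1 ∧ ‖p.1 - T p.1‖ ≤ η ∧ ‖p.2‖ ≤ 1 ∧ p.2 p.1 = 1)
      (fun p q => p.2 q.1 = 0) (fun s _ => by
        obtain ⟨x, hx, hx'⟩ := hcon (s.image Prod.snd)
        have hx0 : ‖x‖ ≠ 0 := fun h => by
          rw [h, mul_zero] at hx'
          exact hx'.not_ge (norm_nonneg _)
        set y : LInfty := (‖x‖ : ℂ)⁻¹ • x with hy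
        have hy1 : ‖y‖ = 1 := by
          rw [hy, norm_smul, norm_inv, Complex.norm_real, norm_norm, inv_mul_cancel₀ hx0]
        obtain ⟨g, hg, hg'⟩ := exists_dual_vector ℂ y (by rw [hy1]; norm_num)
        refine ⟨(y, g), ⟨hy1, ?_, hg.le, ?_⟩, fun p hp => ?_⟩
        · have : y - T y = (‖x‖ : ℂ)⁻¹ • (1 - T) x := by
            rw [hy, map_smul, ← smul_sub]
            rfl
          rw [this, norm_smul, norm_inv, Complex.norm_real, norm_norm, inv_mul_le_iff₀ (by positivity),
            mul_comm]
          exact hx'.le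
        · rw [hg', hy1]
          norm_num
        · rw [hy, map_smul, hx _ (Finset.mem_image_of_mem _ hp), smul_zero])
    obtain ⟨p, hp, hp'⟩ := hseq
    refine (hn' (fun m => (p m).1) (fun a => ?_) fun m => (hp m).2.1).not_gt hn
    exact sum_norm_le_of_triangular (fun i => (p i).1) (fun i => (p i).2) (fun i => (hp i).1)
      (fun i => (hp i).2.2.1) (fun i => (hp i).2.2.2) hp' n a
  let Z : Submodule ℂ LInfty := ⨅ f : s, LinearMap.ker ((f : LInfty →L[ℂ] ℂ) : LInfty →ₗ[ℂ] ℂ)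
  have hZ : ∀ x, x ∈ Z ↔ ∀ f ∈ s, f x = 0 := fun x => by
    simp only [Z, Submodule.mem_iInf, LinearMap.mem_ker, Subtype.forall, ContinuousLinearMap.coe_coe]
  obtain ⟨R, hR⟩ := exists_leftInverse (1 - T) Z hη fun x hx => hs x ((hZ x).1 hx)
  refine ⟨R, finiteDimensional_range_of_ker_le (fun f : s => (f : LInfty →L[ℂ] ℂ)) _ fun x hx => ?_⟩
  have := hR x ((hZ x).2 fun f hf => hx ⟨f, hf⟩)
  rw [sub_apply, mul_apply_eq_comp, this, one_apply_eq_self, sub_self]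

theorem hasSHAI : HasSHAI.{0, v} LInfty := by
  obtain ⟨A, C, hAC⟩ := exists_two_copies
  refine HasSHAI.of_dichotomy A C hAC fun T => ?_
  by_cases hT : ∀ δ > 0, ∀ E : ℕ → Set ℕ, (∀ m n, m < n → Disjoint (E m) (E n)) →
      ∃ n, ‖T.comp (restrict (E n))‖ ≤ δ
  · exact Or.inr (exists_leftInverse_mod_finiteRank T (exhaustiveFamily T hT))
  · push Not at hT
    obtain ⟨δ, hδ, E, hE, hE'⟩ := hT
    exact Or.inl (exists_factorization T hδ E hE hE')

end LInfty

/-! ### The sequence spaces have the SHAI property -/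

theorem proposition1p3 :
    HasSHAI.{0, v} C₀(ℕ, ℂ) ∧
      ∀ (p : ℝ≥0∞) [Fact (1 ≤ p)], HasSHAI.{0, v} (lp (fun _ : ℕ => ℂ) p) := by
  refine ⟨c0Basis.hasSHAI, fun p _ => ?_⟩
  by_cases hp : p = ∞
  · subst hp
    exact LInfty.hasSHAI
  · exact (lpBasis p hp).hasSHAI
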